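/- Let $d\ge 1$ and let $\rho$ be a probability distribution on $\mathbb R^d\times\mathbb R$ such that, for $(a,b)\sim\rho$, $\mathbb E\|a\|^2<\infty$ and $\mathbb E[b^2]<\infty$. Let $\mathcal R(x)=\tfrac12\,\mathbb E(\langle x,a\rangle-b)^2$, let $H=\mathbb E[a\otimes a]$ be invertible, and let $x_*=\arg\min_{x\in\mathbb R^d}\mathcal R(x)$. Let $(a_t,b_t)_{t\ge 0}$ be i.i.d. samples from $\rho$. For step sizes $\alpha,\beta>0$ and $x_0=z_0\in\mathbb R^d$, accelerated SGD is defined for $t\ge 0$ by $$y_{t+1}=x_t-\beta\, g_t,\qquad z_{t+1}=z_t-\alpha(t+1)\,g_t,\qquad (t+2)\,x_{t+1}=(t+1)\,y_{t+1}+z_{t+1},$$ where $g_t=a_t(\langle a_t,x_t\rangle-b_t)$. Assume that, for some finite constant $\kappa$ and every positive semidefinite matrix $M$, the expectation on the left is finite and $$\mathbb E\big[\langle a,Ma\rangle\, a\otimes a\big]\preccurlyeq\kappa\,\mathrm{tr}(MH)\,H .$$ (i) Let $\sigma$ be a finite constant such that $\mathbb E[(b-\langle x_*,a\rangle)^2\,a\otimes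 a]$ is finite and $\preccurlyeq\sigma^2H$. If $\alpha,\beta>0$ satisfy $\kappa(\alpha+2\beta)\,\mathrm{tr}(H)\le 1$ and $\alpha\le\frac{\beta}{2\kappa d}$, then for every $t\ge 1$ the random variable $\mathcal R(x_t)$ is integrable and $$\mathbb E\,\mathcal R(x_t)-\mathcal R(x_*)\le\min\Big\{\frac{3}{\alpha t^2},\frac{24}{\beta t}\Big\}\|x_0-x_*\|^2+2\Big((\alpha+2\beta)\,\mathrm{tr}(H)+\frac{2\alpha d}{\beta}\Big)\sigma^2 .$$ (ii) In particular, suppose the problem is noiseless, i.e. $b=\langle a,x_*\rangle$ $\rho$-almost surely. Then the last iterate converges at the accelerated rate $O(\kappa d/t^2)$: if $\alpha=\frac{\beta}{2\kappa d}$, $\beta>0$ and $\kappa(\alpha+2\beta)\,\mathrm{tr}(H)\le 1$, then for every $t\ge1$ $$\mathbb E\,\mathcal R(x_t)-\mathcal R(x_*)\le\frac{6\kappa d}{\beta t^2}\,\|x_0-x_*\|^2 ;$$ and for $\beta=\frac{1}{3\kappa\,\mathrm{tr}(H)}$, $\alpha=\frac{1}{6d\kappa^2\,\mathrm{tr}(H)}$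 one has, for every $t\ge 1$, $$\mathbb E\,\mathcal R(x_t)-\mathcal R(x_*)\le\frac{18\kappa^2 d\,\mathrm{tr}(H)}{t^2}\,\|x_0-x_*\|^2 .$$ -/

import Mathlib

open MeasureTheory ProbabilityTheory

/-- Population risk `R(x) = ½ E_ρ (⟨x, a⟩ - b)²`, with `(a, b) ∼ ρ`. -/
noncomputable def risk {d : ℕ} (ρ : Measure (EuclideanSpace ℝ (Fin d) × ℝ))
    (x : EuclideanSpace ℝ (Fin d)) : ℝ :=
  (1 / 2) * ∫ p, (inner ℝ x p.1 - p.2) ^ 2 ∂ρ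

/-- The matrix `E_ρ [w(a, b) a ⊗ a]`, computed entry by entry. -/
noncomputable def weightedCov {d : ℕ} (ρ : Measure (EuclideanSpace ℝ (Fin d) × ℝ))
    (w : EuclideanSpace ℝ (Fin d) × ℝ → ℝ) : Matrix (Fin d) (Fin d) ℝ :=
  Matrix.of fun i j => ∫ p, w p * (p.1 i * p.1 j) ∂ρ

/-- The expectation `E_ρ [w(a, b) a ⊗ a]` exists and is finite. -/
def WeightedCovFinite {d : ℕ} (ρ : Measure (EuclideanSpace ℝ (Fin d) × ℝ))
    (w : EuclideanSpace ℝ (Fin d) × ℝ → ℝ) : Prop :=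
  ∀ i j, Integrable (fun p => w p * (p.1 i * p.1 j)) ρ

/-- The covariance `H = E_ρ [a ⊗ a]`. -/
noncomputable def covMatrix {d : ℕ} (ρ : Measure (EuclideanSpace ℝ (Fin d) × ℝ)) :
    Matrix (Fin d) (Fin d) ℝ :=
  Matrix.of fun i j => ∫ p, p.1 i * p.1 j ∂ρ

/-- Noise level: `E [(b - ⟨x⋆, a⟩)² a ⊗ a]` is finite and `≼ σ² H` in the Loewner order. -/
def NoiseLevel {d : ℕ} (ρ : Measure (EuclideanSpace ℝ (Fin d) × ℝ))
    (xstar : EuclideanSpace ℝ (Fin d)) (σ : ℝ) : Prop :=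
  WeightedCovFinite ρ (fun p => (p.2 - inner ℝ xstar p.1) ^ 2) ∧
    (σ ^ 2 • covMatrix ρ - weightedCov ρ (fun p => (p.2 - inner ℝ xstar p.1) ^ 2)).PosSemidef

/-- Uniform kurtosis: for every positive semidefinite `M`,
`E [⟨a, M a⟩ a ⊗ a]` is finite and `≼ κ tr(M H) H` in the Loewner order. -/
def UniformKurtosis {d : ℕ} (ρ : Measure (EuclideanSpace ℝ (Fin d) × ℝ)) (κ : ℝ) : Prop :=
  ∀ M : Matrix (Fin d) (Fin d) ℝ, M.PosSemidef →
    WeightedCovFinite ρ (fun p => inner ℝ p.1 (M.toEuclideanLin p.1)) ∧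
      ((κ * (M * covMatrix ρ).trace) • covMatrix ρ -
        weightedCov ρ (fun p => inner ℝ p.1 (M.toEuclideanLin p.1))).PosSemidef

/-- Stochastic gradient at `x` computed from one sample `(a, b)`: `(⟨a, x⟩ - b) a`. -/
noncomputable def stochGrad {d : ℕ} (p : EuclideanSpace ℝ (Fin d) × ℝ)
    (x : EuclideanSpace ℝ (Fin d)) : EuclideanSpace ℝ (Fin d) :=
  (inner ℝ p.1 x - p.2) • p.1

/-- The pair `(x_t, z_t)` of AcSGD with step sizes `α`, `β`, started from `x₀ = z₀` and run on
the sample sequence `s`:  with `g = ∇_t R(x_t)` the stochastic gradient from the sample `s t`,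
`y_{t+1} = x_t - β g`,  `z_{t+1} = z_t - α (t+1) g`,
`(t+2) x_{t+1} = (t+1) y_{t+1} + z_{t+1}`. -/
noncomputable def acsgdState {d : ℕ} (α β : ℝ) (x₀ : EuclideanSpace ℝ (Fin d))
    (s : ℕ → EuclideanSpace ℝ (Fin d) × ℝ) :
    ℕ → EuclideanSpace ℝ (Fin d) × EuclideanSpace ℝ (Fin d)
  | 0 => (x₀, x₀)
  | t + 1 =>
    let x := (acsgdState α β x₀ s t).1
    let z := (acsgdState α β x₀ s t).2
    let g := stochGrad (s t) x
    let y' := x - β • g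
    let z' := z - (α * ((t : ℝ) + 1)) • g
    (((t : ℝ) + 2)⁻¹ • (((t : ℝ) + 1) • y' + z'), z')

/-- The iterate `x_t` of AcSGD. -/
noncomputable def acsgd {d : ℕ} (α β : ℝ) (x₀ : EuclideanSpace ℝ (Fin d))
    (s : ℕ → EuclideanSpace ℝ (Fin d) × ℝ) (t : ℕ) : EuclideanSpace ℝ (Fin d) :=
  (acsgdState α β x₀ s t).1

/-- `E R(x_t) - R(x⋆) ≤ B`, where `x_t` is the AcSGD iterate run on the random samples `ξ`;
that `R(x_t)` has a finite expectation is part of the claim. -/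
def ExcessRiskLE {d : ℕ} {Ω : Type*} [MeasurableSpace Ω] (P : Measure Ω)
    (ρ : Measure (EuclideanSpace ℝ (Fin d) × ℝ)) (ξ : ℕ → Ω → EuclideanSpace ℝ (Fin d) × ℝ)
    (x₀ xstar : EuclideanSpace ℝ (Fin d)) (α β : ℝ) (t : ℕ) (B : ℝ) : Prop :=
  Integrable (fun ω => risk ρ (acsgd α β x₀ (fun n => ξ n ω) t)) P ∧
    (∫ ω, risk ρ (acsgd α β x₀ (fun n => ξ n ω) t) ∂P) - risk ρ xstar ≤ B

/-! The rescaling `u = t (y_t - x⋆)`, `v = z_t - x⋆` removes time from the algorithm: `u + v = (t +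
1) (x_t - x⋆)`, and the step becomes a fixed random linear map driven by noise of magnitude `τ t = t
+ 1`. In an eigenbasis of `H` its mean splits into independent two-dimensional systems, one per
eigenvalue `λ`, with parameters `a = αλ`, `b = βλ`.

Fluctuations are controlled through `Φ t s`, the `λ`-weighted second moment of the position when `t`
stochastic steps are followed by `s` mean steps. Trading one stochastic step for a mean step costs
at most `k s * (κ * Φ t 0 + τ t ^ 2 * σ2)`, where `k s` is the squared response of the modes to an
impulse of age `s`; this is where kurtosis and noise level enter. The total mass `K` of the kernel
is bounded by a Lyapunov function (`sum_modePos_sq_le`), the step sizes give `κ K ≤ 2 / 3`, and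
`volterra_bound` closes the recursion up to a factor 3. What remains is the bias of the mean
dynamics: `modePos_sq_le` gives the rate `1 / (α t²)`, `mul_modePos_sq_le` the rate `1 / (β t)`.

The noise need not be independent of the features, so a cross term between noise and state appears.
It is linear in the mean position, hence disappears when there is no noise or when the error is
centred. The trajectory is therefore split by superposition into a noiseless part and a part started
at `x⋆`; the factor 2 this costs is absorbed by the `1 / 2` in the risk. -/

/-! ### Deterministic dynamics of one mode. -/

/-- The position `u + v` after `s` steps of the one-dimensional deterministic accelerated dynamics
`(u, v) ↦ ((1 - b) (u + v), v - a (u + v))`. -/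
def modePos (a b : ℝ) : ℕ → ℝ → ℝ → ℝ
  | 0, u, v => u + v
  | s + 1, u, v => modePos a b s ((1 - b) * (u + v)) (v - a * (u + v))

lemma modePos_linear (a b : ℝ) (s : ℕ) (c c' u v u' v' : ℝ) :
    modePos a b s (c * u + c' * u') (c * v + c' * v') =
      c * modePos a b s u v + c' * modePos a b s u' v' := by
  induction s generalizing u v u' v' with
  | zero => simp only [modePos]; ring
  | succ s ih =>
    simp only [modePos]
    rw [← ih]
    congr 1 <;> ring

lemma modePos_eq (a b : ℝ) (s : ℕ) (u v : ℝ) :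
    modePos a b s u v = u * modePos a b s 1 0 + v * modePos a b s 0 1 := by
  rw [← modePos_linear]; simp

/-- The energy `a u² + v²` dominates the squared position along the dynamics. -/
lemma modePos_energy {a b : ℝ} (ha : 0 ≤ a) (hab : a ≤ 2 * b - b ^ 2) (s : ℕ) (u v : ℝ) :
    a * modePos a b s u v ^ 2 ≤ (1 + a) * (a * u ^ 2 + v ^ 2) := by
  induction s generalizing u v with
  | zero =>
    simp only [modePos]
    nlinarith [sq_nonneg (a * u - v)]
  | succ s ih =>
    refine (ih _ _).trans (mul_le_mul_of_nonneg_left ?_ (by linarith))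
    -- One step lowers the energy by exactly `a (2b - b² - a) (u + v)² + a v²`.
    nlinarith [mul_nonneg (mul_nonneg ha (sub_nonneg.2 hab)) (sq_nonneg (u + v)),
      mul_nonneg ha (sq_nonneg v)]

/-- Accelerated bound on the bias of a single mode. -/
lemma modePos_sq_le {a b : ℝ} (ha : 0 ≤ a) (ha' : a ≤ 1) (hab : a ≤ 2 * b - b ^ 2) (s : ℕ)
    (w : ℝ) : a * modePos a b s 0 w ^ 2 ≤ w ^ 2 := by
  cases s with
  | zero => simp only [modePos]; nlinarith [sq_nonneg w]
  | succ s =>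
    refine (modePos_energy ha hab s _ _).trans ?_
    -- Started from `u = 0`, the first step already shrinks the energy by `1 - a`, which offsets the
    -- factor `1 + a` of `modePos_energy`.
    have h1 : a * ((1 - b) * (0 + w)) ^ 2 + (w - a * (0 + w)) ^ 2 ≤ (1 - a) * w ^ 2 := by
      nlinarith [mul_nonneg (mul_nonneg ha (sub_nonneg.2 hab)) (sq_nonneg w)]
    calc _ ≤ (1 + a) * ((1 - a) * w ^ 2) := mul_le_mul_of_nonneg_left h1 (by linarith)
      _ ≤ w ^ 2 := by nlinarith [mul_nonneg (sq_nonneg a) (sq_nonneg w)]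

/-- Slow-rate bound on the bias of a single mode. -/
lemma abs_modePos_le_of_energy {a b : ℝ} (ha : 0 ≤ a) (hb : 0 ≤ b) (hb' : b ≤ 1)
    (hab : a ≤ 2 * b - b ^ 2) {W : ℝ} (hW : 0 ≤ W) (s : ℕ) (u v m : ℝ) (hm : 0 ≤ m)
    (hmb : b * m ≤ 1) (hE : a * u ^ 2 + v ^ 2 ≤ W ^ 2) (hp : |u + v| ≤ m * W) :
    |modePos a b s u v| ≤ (m + s) * W ∧ b * |modePos a b s u v| ≤ W := by
  induction s generalizing u v m with
  | zero =>
    simp only [modePos, Nat.cast_zero, add_zero]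
    refine ⟨hp, ?_⟩
    calc _ ≤ b * (m * W) := mul_le_mul_of_nonneg_left hp hb
      _ = b * m * W := by ring
      _ ≤ 1 * W := mul_le_mul_of_nonneg_right hmb hW
      _ = W := one_mul W
  | succ s ih =>
    have hE' : a * ((1 - b) * (u + v)) ^ 2 + (v - a * (u + v)) ^ 2 ≤ W ^ 2 := by
      nlinarith [mul_nonneg (mul_nonneg ha (sub_nonneg.2 hab)) (sq_nonneg (u + v)),
        mul_nonneg ha (sq_nonneg v)]
    have hv' : |v - a * (u + v)| ≤ W := by
      refine abs_le_of_sq_le_sq ?_ hW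
      nlinarith [mul_nonneg ha (sq_nonneg ((1 - b) * (u + v)))]
    -- Since the energy keeps `|v| ≤ W`, the bound on the position evolves by `m ↦ (1 - b) m + 1`.
    -- This map raises `m` by at most 1, hence the linear growth, and preserves `b m ≤ 1`, hence the
    -- uniform bound.
    have hp' : |(1 - b) * (u + v) + (v - a * (u + v))| ≤ ((1 - b) * m + 1) * W := by
      refine (abs_add_le _ _).trans ?_
      rw [abs_mul, abs_of_nonneg (sub_nonneg.2 hb')]
      nlinarith [mul_le_mul_of_nonneg_left hp (sub_nonneg.2 hb')]
    have hm' : 0 ≤ (1 - b) * m + 1 := by nlinarith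
    obtain ⟨h1, h2⟩ := ih _ _ _ hm' (by nlinarith) hE' hp'
    refine ⟨h1.trans (mul_le_mul_of_nonneg_right ?_ hW), h2⟩
    push_cast
    nlinarith

/-- One factor of the square is bounded by linear growth in `s`, the other, weighted by `b`,
uniformly in `s`. -/
lemma mul_modePos_sq_le {a b : ℝ} (ha : 0 ≤ a) (hb : 0 ≤ b) (hb' : b ≤ 1)
    (hab : a ≤ 2 * b - b ^ 2) (s : ℕ) (w : ℝ) :
    b * modePos a b s 0 w ^ 2 ≤ (s + 1) * w ^ 2 := by
  obtain ⟨h1, h2⟩ := abs_modePos_le_of_energy ha hb hb' hab (abs_nonneg w) s 0 w 1 zero_le_one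
    (by linarith) (by rw [sq_abs]; linarith) (by simp)
  calc b * modePos a b s 0 w ^ 2
      = (b * |modePos a b s 0 w|) * |modePos a b s 0 w| := by rw [← sq_abs]; ring
    _ ≤ |w| * ((1 + s) * |w|) := mul_le_mul h2 h1 (abs_nonneg _) (abs_nonneg _)
    _ = (s + 1) * w ^ 2 := by rw [← sq_abs w]; ring

/-- The total squared response of a mode to an impulse in the direction `(b, a)`. -/
lemma sum_modePos_sq_le {a b : ℝ} (ha : 0 < a) (hb : 0 < b) (hab : a + 2 * b ≤ 1) (n : ℕ) :
    ∑ s ∈ Finset.range n, modePos a b s b a ^ 2 ≤ (2 * (a / b) + (a + 2 * b)) / 3 := by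
  have hD : 0 < 4 - a - 2 * b := by linarith
  -- The right side is a Lyapunov function: one step decreases it by exactly `a b (4 - a - 2b) (u +
  -- v)²`, so the sum telescopes. The step-size condition makes the last factor at least 3.
  have key : ∀ (n : ℕ) (u v : ℝ), a * b * (4 - a - 2 * b) *
      ∑ s ∈ Finset.range n, modePos a b s u v ^ 2 ≤
        2 * a * (u + v) ^ 2 - 2 * a * (u + v) * v + (2 - b) * v ^ 2 := by
    intro n
    induction n with
    | zero =>
      intro u v
      simp only [Finset.range_zero, Finset.sum_empty, mul_zero]
      nlinarith [mul_nonneg ha.le (sq_nonneg (2 * (u + v) - v)), sq_nonneg v,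
        mul_nonneg hb.le (sq_nonneg v), mul_nonneg ha.le (sq_nonneg v)]
    | succ n ih =>
      intro u v
      rw [Finset.sum_range_succ', mul_add]
      have := ih ((1 - b) * (u + v)) (v - a * (u + v))
      simp only [modePos] at this ⊢
      refine (add_le_add_left this _).trans (le_of_eq ?_)
      ring
  have h := key n b a
  have h2 : (0 : ℝ) ≤ ∑ s ∈ Finset.range n, modePos a b s b a ^ 2 :=
    Finset.sum_nonneg fun _ _ => sq_nonneg _
  have h3 : b * (4 - a - 2 * b) * ∑ s ∈ Finset.range n, modePos a b s b a ^ 2 ≤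
      2 * a + b * (a + 2 * b) := by
    refine le_of_mul_le_mul_left ?_ ha
    calc _ = _ := by ring
      _ ≤ _ := h
      _ = _ := by ring
  have h4 : b * 3 * ∑ s ∈ Finset.range n, modePos a b s b a ^ 2 ≤ 2 * a + b * (a + 2 * b) := by
    nlinarith [mul_nonneg (mul_nonneg hb.le (sub_nonneg.2 hab)) h2]
  rw [le_div_iff₀ (by norm_num)]
  refine le_of_mul_le_mul_left ?_ hb
  have : b * (2 * (a / b) + (a + 2 * b)) = 2 * a + b * (a + 2 * b) := by field_simp
  rw [this]; linarith

/-! ### The stochastic recursion in eigencoordinates. -/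

/-- One step of accelerated SGD for the rescaled errors `u = t (y_t - x⋆)`, `v = z_t - x⋆`, in
coordinates, with a noise of magnitude `τ`. -/
def modeStep {ι : Type*} [Fintype ι] (α β τ : ℝ) (z : (ι → ℝ) × ℝ)
    (θ : (ι → ℝ) × (ι → ℝ)) : (ι → ℝ) × (ι → ℝ) :=
  (fun i => θ.1 i + θ.2 i - β * (z.1 i * (∑ j, z.1 j * (θ.1 j + θ.2 j) - τ * z.2)),
    fun i => θ.2 i - α * (z.1 i * (∑ j, z.1 j * (θ.1 j + θ.2 j) - τ * z.2)))

/-- The rescaled errors of accelerated SGD, in coordinates. -/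
def modeState {ι : Type*} [Fintype ι] (α β : ℝ) (τ : ℕ → ℝ) (w : ι → ℝ)
    (z : ℕ → (ι → ℝ) × ℝ) : ℕ → (ι → ℝ) × (ι → ℝ)
  | 0 => (0, w)
  | t + 1 => modeStep α β (τ t) (z t) (modeState α β τ w z t)

/-- Moment conditions on a sample `(a, ε)` of features and noise, in coordinates that diagonalize
the covariance. -/
structure ModeMoments {ι : Type*} [Fintype ι] [DecidableEq ι] (ν : Measure ((ι → ℝ) × ℝ))
    (lam : ι → ℝ) (κ σ2 : ℝ) : Prop where
  memLp_cov : ∀ i j, MemLp (fun z => z.1 i * z.1 j) 2 ν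
  memLp_noise : ∀ i, MemLp (fun z => z.2 * z.1 i) 2 ν
  integral_cov : ∀ i j, ∫ z, z.1 i * z.1 j ∂ν = if i = j then lam i else 0
  integral_noise : ∀ i, ∫ z, z.2 * z.1 i ∂ν = 0
  kurtosis : ∀ i (p : ι → ℝ),
    ∫ z, (z.1 i * ∑ j, z.1 j * p j) ^ 2 ∂ν ≤ κ * lam i * ∑ j, lam j * p j ^ 2
  noise_sq : ∀ i, ∫ z, (z.2 * z.1 i) ^ 2 ∂ν ≤ σ2 * lam i

/-- The stochastic step is the mean step minus a fluctuation in the direction `(β, α)`; by linearity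
the fluctuation is then propagated as an impulse through `s` mean steps. -/
lemma modePos_modeStep {ι : Type*} [Fintype ι] (lam : ι → ℝ) (α β τ : ℝ) (z : (ι → ℝ) × ℝ) (θ : (ι → ℝ) × (ι → ℝ)) (s : ℕ) (i : ι) :
    modePos (α * lam i) (β * lam i) s ((modeStep α β τ z θ).1 i) ((modeStep α β τ z θ).2 i) =
      modePos (α * lam i) (β * lam i) (s + 1) (θ.1 i) (θ.2 i)
        - modePos (α * lam i) (β * lam i) s β α *
          (z.1 i * (∑ j, z.1 j * (θ.1 j + θ.2 j) - τ * z.2) - lam i * (θ.1 i + θ.2 i)) := by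
  simp only [modePos, modeStep]
  rw [modePos_eq, modePos_eq _ _ s (_ * _) _, modePos_eq _ _ s β α]
  ring

/-- Matches the impulse `(b, a)` of `sum_modePos_sq_le` with the direction `(β, α)` of the
stochastic gradient. -/
lemma modePos_mul_impulse (α β c : ℝ) (s : ℕ) :
    modePos (α * c) (β * c) s (β * c) (α * c) = c * modePos (α * c) (β * c) s β α := by
  have := modePos_linear (α * c) (β * c) s c 0 β α 0 0
  simpa [mul_comm c] using this

/-! ### Moments over one sample. -/

section Moments

variable {ι : Type*} [Fintype ι] [DecidableEq ι] {ν : Measure ((ι → ℝ) × ℝ)} {lam : ι → ℝ}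
  {κ σ2 : ℝ}

lemma ModeMoments.memLp_mul_sum (h : ModeMoments ν lam κ σ2) (i : ι) (p : ι → ℝ) :
    MemLp (fun z : (ι → ℝ) × ℝ => z.1 i * ∑ j, z.1 j * p j) 2 ν := by
  have : (fun z : (ι → ℝ) × ℝ => z.1 i * ∑ j, z.1 j * p j) =
      fun z => ∑ j, p j * (z.1 i * z.1 j) := by
    ext z; rw [Finset.mul_sum]; exact Finset.sum_congr rfl fun j _ => by ring
  rw [this]
  exact memLp_finsetSum _ fun j _ => (h.memLp_cov i j).const_mul (p j)

lemma ModeMoments.integral_mul_sum [IsProbabilityMeasure ν] (h : ModeMoments ν lam κ σ2) (i : ι)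
    (p : ι → ℝ) : ∫ z, z.1 i * ∑ j, z.1 j * p j ∂ν = lam i * p i := by
  have : (fun z : (ι → ℝ) × ℝ => z.1 i * ∑ j, z.1 j * p j) =
      fun z => ∑ j, p j * (z.1 i * z.1 j) := by
    ext z; rw [Finset.mul_sum]; exact Finset.sum_congr rfl fun j _ => by ring
  rw [this, integral_finsetSum _ fun j _ =>
    ((h.memLp_cov i j).integrable one_le_two).const_mul (p j)]
  simp [integral_const_mul, h.integral_cov, mul_comm]

lemma ModeMoments.integral_noise_mul_sum (h : ModeMoments ν lam κ σ2) (i : ι)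
    (p : ι → ℝ) : ∫ z, (z.2 * z.1 i) * (z.1 i * ∑ j, z.1 j * p j) ∂ν =
      ∑ j, (∫ z, (z.2 * z.1 i) * (z.1 i * z.1 j) ∂ν) * p j := by
  have : (fun z : (ι → ℝ) × ℝ => (z.2 * z.1 i) * (z.1 i * ∑ j, z.1 j * p j)) =
      fun z => ∑ j, ((z.2 * z.1 i) * (z.1 i * z.1 j)) * p j := by
    ext z; rw [Finset.mul_sum, Finset.mul_sum]; exact Finset.sum_congr rfl fun j _ => by ring
  have hint : ∀ j, Integrable (fun z : (ι → ℝ) × ℝ => (z.2 * z.1 i) * (z.1 i * z.1 j) * p j) ν :=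
    fun j => ((h.memLp_noise i).integrable_mul (h.memLp_cov i j)).mul_const (p j)
  rw [this, integral_finsetSum _ fun j _ => hint j]
  simp [integral_mul_const]

/-- Second moment, over one sample, of a linear observable of a coordinate of the next state. -/
lemma ModeMoments.integral_sq_le [IsProbabilityMeasure ν] (h : ModeMoments ν lam κ σ2) (i : ι)
    (p : ι → ℝ) (q l τ : ℝ) :
    ∫ z, (q - l * (z.1 i * (∑ j, z.1 j * p j - τ * z.2) - lam i * p i)) ^ 2 ∂ν ≤
      q ^ 2 + l ^ 2 * (κ * lam i * ∑ j, lam j * p j ^ 2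
        - 2 * τ * (∑ j, (∫ z, (z.2 * z.1 i) * (z.1 i * z.1 j) ∂ν) * p j)
        + τ ^ 2 * (σ2 * lam i)) := by
  -- `m` gathers everything that does not depend on the sample.
  set m := q + l * (lam i * p i) with hm
  have hG := h.memLp_mul_sum i p
  have hE := h.memLp_noise i
  have hexp : (fun z : (ι → ℝ) × ℝ =>
      (q - l * (z.1 i * (∑ j, z.1 j * p j - τ * z.2) - lam i * p i)) ^ 2) =
        (fun _ => m ^ 2) + (fun z => l ^ 2 * (z.1 i * ∑ j, z.1 j * p j) ^ 2)
        + (fun z => (l ^ 2 * τ ^ 2) * (z.2 * z.1 i) ^ 2)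
        + (fun z => (-2 * m * l) * (z.1 i * ∑ j, z.1 j * p j))
        + (fun z => (2 * m * l * τ) * (z.2 * z.1 i))
        + (fun z => (-2 * l ^ 2 * τ) * ((z.2 * z.1 i) * (z.1 i * ∑ j, z.1 j * p j))) := by
    ext z; simp only [Pi.add_apply]; rw [hm]; ring
  have i1 : Integrable (fun _ : (ι → ℝ) × ℝ => m ^ 2) ν := integrable_const _
  have i2 := hG.integrable_sq.const_mul (l ^ 2)
  have i3 := hE.integrable_sq.const_mul (l ^ 2 * τ ^ 2)
  have i4 := (hG.integrable one_le_two).const_mul (-2 * m * l)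
  have i5 := (hE.integrable one_le_two).const_mul (2 * m * l * τ)
  have i6 : Integrable (fun z : (ι → ℝ) × ℝ =>
      (-2 * l ^ 2 * τ) * ((z.2 * z.1 i) * (z.1 i * ∑ j, z.1 j * p j))) ν :=
    (hE.integrable_mul hG).const_mul (-2 * l ^ 2 * τ)
  rw [hexp, integral_add' ((((i1.add i2).add i3).add i4).add i5) i6,
    integral_add' (((i1.add i2).add i3).add i4) i5, integral_add' ((i1.add i2).add i3) i4,
    integral_add' (i1.add i2) i3, integral_add' i1 i2]
  have e6 : ∫ z, (-2 * l ^ 2 * τ) * ((z.2 * z.1 i) * (z.1 i * ∑ j, z.1 j * p j)) ∂ν =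
      (-2 * l ^ 2 * τ) * ∑ j, (∫ z, (z.2 * z.1 i) * (z.1 i * z.1 j) ∂ν) * p j := by
    rw [integral_const_mul, h.integral_noise_mul_sum]
  rw [e6]
  simp only [integral_const_mul, integral_const, probReal_univ, smul_eq_mul, one_mul,
    h.integral_mul_sum, h.integral_noise]
  have k1 := mul_le_mul_of_nonneg_left (h.kurtosis i p) (sq_nonneg l)
  have k2 := mul_le_mul_of_nonneg_left (h.noise_sq i) (mul_nonneg (sq_nonneg l) (sq_nonneg τ))
  -- The variance of the gradient is at most its second moment: the squared mean is discarded.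
  have k3 : 0 ≤ (l * (lam i * p i)) ^ 2 := sq_nonneg _
  rw [hm]
  nlinarith

end Moments

/-! ### Dependence on the past and independence of the next sample. -/

lemma measurable_modeStep {ι : Type*} [Fintype ι] (α β τ : ℝ) :
    Measurable fun x : ((ι → ℝ) × ℝ) × ((ι → ℝ) × (ι → ℝ)) => modeStep α β τ x.1 x.2 := by
  unfold modeStep
  refine Measurable.prodMk ?_ ?_ <;> refine measurable_pi_lambda _ fun i => ?_ <;> fun_prop

/-- The state at time `t` is a measurable function of the samples before time `t`. -/
lemma exists_measurable_modeState_eq {ι : Type*} [Fintype ι] (α β : ℝ) (τ : ℕ → ℝ) (w : ι → ℝ)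
    (t : ℕ) : ∃ F : (Finset.range t → (ι → ℝ) × ℝ) → (ι → ℝ) × (ι → ℝ), Measurable F ∧
      ∀ z : ℕ → (ι → ℝ) × ℝ, modeState α β τ w z t = F fun i => z i := by
  induction t with
  | zero => exact ⟨fun _ => (0, w), measurable_const, fun z => rfl⟩
  | succ t ih =>
    obtain ⟨F, hF, hFz⟩ := ih
    refine ⟨fun z => modeStep α β (τ t) (z ⟨t, Finset.self_mem_range_succ t⟩)
      (F fun i => z ⟨i, Finset.mem_range.2 ((Finset.mem_range.1 i.2).trans t.lt_succ_self)⟩),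
      ?_, fun z => ?_⟩
    · refine (measurable_modeStep α β (τ t)).comp (Measurable.prodMk (measurable_pi_apply _)
        (hF.comp (measurable_pi_lambda _ fun i => measurable_pi_apply _)))
    · simp only [modeState, hFz]

section Past

variable {ι : Type*} [Fintype ι] {Ω : Type*} [MeasurableSpace Ω] {P : Measure Ω}
  {ζ : ℕ → Ω → (ι → ℝ) × ℝ}

lemma aemeasurable_modeState (hζ : ∀ n, AEMeasurable (ζ n) P) (α β : ℝ) (τ : ℕ → ℝ) (w : ι → ℝ)
    (t : ℕ) : AEMeasurable (fun ω => modeState α β τ w (fun n => ζ n ω) t) P := by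
  obtain ⟨F, hF, hFz⟩ := exists_measurable_modeState_eq α β τ w t
  simp only [hFz]
  exact hF.comp_aemeasurable (aemeasurable_pi_lambda _ fun i => hζ i)

lemma indepFun_modeState (hζ : ∀ n, AEMeasurable (ζ n) P) (hind : iIndepFun ζ P) (α β : ℝ)
    (τ : ℕ → ℝ) (w : ι → ℝ) (t : ℕ) :
    IndepFun (fun ω => modeState α β τ w (fun n => ζ n ω) t) (ζ t) P := by
  obtain ⟨F, hF, hFz⟩ := exists_measurable_modeState_eq α β τ w t
  simp only [hFz]
  have := hind.indepFun_finset₀ (Finset.range t) {t} (by simp) hζ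
  exact this.comp (φ := F) (ψ := fun z : ({t} : Finset ℕ) → (ι → ℝ) × ℝ =>
    z ⟨t, Finset.mem_singleton_self t⟩) hF (measurable_pi_apply _)

end Past

/-- Bounding an expectation over an independent pair by integrating out the second variable. -/
lemma integral_le_of_indepFun {Ω X Y : Type*} [MeasurableSpace Ω] [MeasurableSpace X]
    [MeasurableSpace Y] {P : Measure Ω} [IsProbabilityMeasure P] {ν : Measure Y}
    [IsProbabilityMeasure ν]
    {θ : Ω → X} {z : Ω → Y} (hθ : AEMeasurable θ P) (hz : HasLaw z ν P) (hind : IndepFun θ z P)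
    {g : X × Y → ℝ} (hg : Measurable g) (hgi : Integrable (fun ω => g (θ ω, z ω)) P)
    {G : X → ℝ} (hG : Measurable G) (hGi : Integrable (fun ω => G (θ ω)) P)
    (hle : ∀ x, ∫ y, g (x, y) ∂ν ≤ G x) :
    ∫ ω, g (θ ω, z ω) ∂P ≤ ∫ ω, G (θ ω) ∂P := by
  have hpair : AEMeasurable (fun ω => (θ ω, z ω)) P := hθ.prodMk hz.aemeasurable
  have hmap := (indepFun_iff_map_prod_eq_prod_map_map hθ hz.aemeasurable).1 hind
  rw [hz.map_eq] at hmap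
  have : IsProbabilityMeasure (P.map θ) := Measure.isProbabilityMeasure_map hθ
  have hgi' : Integrable g ((P.map θ).prod ν) := by
    rw [← hmap, integrable_map_measure hg.aestronglyMeasurable hpair]; exact hgi
  rw [← integral_map hpair hg.aestronglyMeasurable, hmap, integral_prod _ hgi',
    ← integral_map hθ hG.aestronglyMeasurable]
  refine integral_mono hgi'.integral_prod_left ?_ hle
  rw [integrable_map_measure hG.aestronglyMeasurable hθ]
  exact hGi

/-- Independence replaces the fourth moments that Hölder would require: the square is a product of
independent integrable variables. -/
lemma memLp_two_mul_of_indepFun {Ω : Type*} [MeasurableSpace Ω] {P : Measure Ω} {X Y : Ω → ℝ}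
    (h : IndepFun X Y P) (hX : MemLp X 2 P) (hY : MemLp Y 2 P) :
    MemLp (fun ω => X ω * Y ω) 2 P := by
  have hm : AEStronglyMeasurable (fun ω => X ω * Y ω) P := hX.1.mul hY.1
  rw [memLp_two_iff_integrable_sq hm]
  have h2 : IndepFun (fun ω => X ω ^ 2) (fun ω => Y ω ^ 2) P :=
    h.comp (φ := fun x : ℝ => x ^ 2) (ψ := fun x : ℝ => x ^ 2) (by fun_prop) (by fun_prop)
  have := h2.integrable_mul hX.integrable_sq hY.integrable_sq
  simpa [mul_pow, Pi.mul_def] using this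

lemma memLp_comp_of_hasLaw {Ω Y : Type*} [MeasurableSpace Ω] [MeasurableSpace Y] {P : Measure Ω}
    {ν : Measure Y} {z : Ω → Y} (hz : HasLaw z ν P) {f : Y → ℝ} (hf : MemLp f 2 ν) :
    MemLp (fun ω => f (z ω)) 2 P := by
  rw [← hz.map_eq] at hf
  exact hf.comp_of_map hz.aemeasurable

lemma memLp_modePos {Ω : Type*} [MeasurableSpace Ω] {μ : Measure Ω} (a b : ℝ) (s : ℕ) {u v : Ω → ℝ} (hu : MemLp u 2 μ)
    (hv : MemLp v 2 μ) : MemLp (fun ω => modePos a b s (u ω) (v ω)) 2 μ := by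
  simp only [modePos_eq a b s (u _) (v _)]
  exact (hu.mul_const _).add (hv.mul_const _)

lemma measurable_modePos (a b : ℝ) (s : ℕ) : Measurable fun x : ℝ × ℝ => modePos a b s x.1 x.2 := by
  simp only [modePos_eq a b s (Prod.fst _) (Prod.snd _)]
  fun_prop

/-! ### The one-step inequality. -/

section Step

variable {ι : Type*} [Fintype ι] [DecidableEq ι] {ν : Measure ((ι → ℝ) × ℝ)}
  {lam : ι → ℝ} {κ σ2 : ℝ} {Ω : Type*} [MeasurableSpace Ω] {P : Measure Ω}
  {θ : Ω → (ι → ℝ) × (ι → ℝ)} {z : Ω → (ι → ℝ) × ℝ}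

lemma mul_sum_sub_eq {ι : Type*} [Fintype ι] (z : (ι → ℝ) × ℝ) (p : ι → ℝ) (τ : ℝ) (i : ι) :
    z.1 i * (∑ j, z.1 j * p j - τ * z.2) =
      ∑ j, p j * (z.1 i * z.1 j) - τ * (z.2 * z.1 i) := by
  rw [mul_sub, Finset.mul_sum]
  congr 1
  · exact Finset.sum_congr rfl fun j _ => by ring
  · ring

/-- The stochastic correction in one step is square integrable. -/
lemma ModeMoments.memLp_residual (h : ModeMoments ν lam κ σ2)
    (hz : HasLaw z ν P) (hind : IndepFun θ z P) (h1 : ∀ i, MemLp (fun ω => (θ ω).1 i) 2 P)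
    (h2 : ∀ i, MemLp (fun ω => (θ ω).2 i) 2 P) (τ : ℝ) (i : ι) :
    MemLp (fun ω => (z ω).1 i *
      (∑ j, (z ω).1 j * ((θ ω).1 j + (θ ω).2 j) - τ * (z ω).2)) 2 P := by
  simp only [mul_sum_sub_eq (z _) (fun j => (θ _).1 j + (θ _).2 j)]
  have hn : MemLp (fun ω => (z ω).2 * (z ω).1 i) 2 P :=
    memLp_comp_of_hasLaw hz (h.memLp_noise i)
  have hmul : ∀ j, MemLp
      (fun ω => ((θ ω).1 j + (θ ω).2 j) * ((z ω).1 i * (z ω).1 j)) 2 P := fun j =>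
    memLp_two_mul_of_indepFun
      (hind.comp (φ := fun x : (ι → ℝ) × (ι → ℝ) => x.1 j + x.2 j)
        (ψ := fun y : (ι → ℝ) × ℝ => y.1 i * y.1 j) (by fun_prop) (by fun_prop))
      ((h1 j).add (h2 j)) (memLp_comp_of_hasLaw hz (h.memLp_cov i j))
  exact (memLp_finsetSum Finset.univ fun j _ => hmul j).sub (hn.const_mul τ)

variable [IsProbabilityMeasure P]

lemma ModeMoments.integral_residual (h : ModeMoments ν lam κ σ2)
    (hz : HasLaw z ν P) (hind : IndepFun θ z P) (h1 : ∀ i, MemLp (fun ω => (θ ω).1 i) 2 P)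
    (h2 : ∀ i, MemLp (fun ω => (θ ω).2 i) 2 P)
    (h0 : ∀ j, ∫ ω, ((θ ω).1 j + (θ ω).2 j) ∂P = 0) (τ : ℝ) (i : ι) :
    ∫ ω, (z ω).1 i * (∑ j, (z ω).1 j * ((θ ω).1 j + (θ ω).2 j) - τ * (z ω).2) ∂P = 0 := by
  have hn : MemLp (fun ω => (z ω).2 * (z ω).1 i) 2 P :=
    memLp_comp_of_hasLaw hz (h.memLp_noise i)
  have hc : ∀ j, MemLp (fun ω => (z ω).1 i * (z ω).1 j) 2 P := fun j =>
    memLp_comp_of_hasLaw hz (h.memLp_cov i j)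
  have hi : ∀ j, IndepFun (fun ω => (θ ω).1 j + (θ ω).2 j)
      (fun ω => (z ω).1 i * (z ω).1 j) P := fun j =>
    hind.comp (φ := fun x : (ι → ℝ) × (ι → ℝ) => x.1 j + x.2 j)
      (ψ := fun y : (ι → ℝ) × ℝ => y.1 i * y.1 j) (by fun_prop) (by fun_prop)
  have hp : ∀ j, MemLp (fun ω => (θ ω).1 j + (θ ω).2 j) 2 P := fun j => (h1 j).add (h2 j)
  have hmul : ∀ j, Integrable
      (fun ω => ((θ ω).1 j + (θ ω).2 j) * ((z ω).1 i * (z ω).1 j)) P := fun j =>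
    (hp j).integrable_mul (hc j)
  have hn0 : ∫ ω, (z ω).2 * (z ω).1 i ∂P = 0 := by
    rw [← h.integral_noise i, ← hz.map_eq, integral_map hz.aemeasurable
      (by fun_prop : Measurable fun y : (ι → ℝ) × ℝ => y.2 * y.1 i).aestronglyMeasurable]
  simp only [mul_sum_sub_eq (z _) (fun j => (θ _).1 j + (θ _).2 j)]
  rw [integral_sub (integrable_finsetSum _ fun j _ => hmul j)
    ((hn.integrable one_le_two).const_mul τ), integral_finsetSum _ fun j _ => hmul j,
    integral_const_mul, hn0, mul_zero, sub_zero]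
  refine Finset.sum_eq_zero fun j _ => ?_
  rw [(hi j).integral_fun_mul_eq_mul_integral (hp j).1 (hc j).1, h0, zero_mul]

/-- One step of the recursion for the second moments of a mode. -/
lemma ModeMoments.integral_modePos_sq_le [IsProbabilityMeasure ν] (h : ModeMoments ν lam κ σ2)
    (hθ : AEMeasurable θ P)
    (hz : HasLaw z ν P) (hind : IndepFun θ z P) (h1 : ∀ i, MemLp (fun ω => (θ ω).1 i) 2 P)
    (h2 : ∀ i, MemLp (fun ω => (θ ω).2 i) 2 P) (α β τ : ℝ)
    (h0 : ∀ j, τ * ∫ ω, ((θ ω).1 j + (θ ω).2 j) ∂P = 0) (s : ℕ) (i : ι) :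
    ∫ ω, modePos (α * lam i) (β * lam i) s ((modeStep α β τ (z ω) (θ ω)).1 i)
        ((modeStep α β τ (z ω) (θ ω)).2 i) ^ 2 ∂P ≤
      ∫ ω, modePos (α * lam i) (β * lam i) (s + 1) ((θ ω).1 i) ((θ ω).2 i) ^ 2 ∂P
        + modePos (α * lam i) (β * lam i) s β α ^ 2 * lam i *
          (κ * ∑ j, lam j * ∫ ω, ((θ ω).1 j + (θ ω).2 j) ^ 2 ∂P + τ ^ 2 * σ2) := by
  set l := modePos (α * lam i) (β * lam i) s β α with hl
  have hp : ∀ j, MemLp (fun ω => (θ ω).1 j + (θ ω).2 j) 2 P := fun j => (h1 j).add (h2 j)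
  have hq := memLp_modePos (α * lam i) (β * lam i) (s + 1) (h1 i) (h2 i)
  have hr := h.memLp_residual hz hind h1 h2 τ i
  have hN := ((hr.sub ((hp i).const_mul (lam i))).const_mul l)
  have hsq := (hq.sub hN).integrable_sq
  simp only [Pi.sub_apply] at hsq
  simp only [modePos_modeStep, ← hl]
  let c : ι → ℝ := fun j => ∫ y, (y.2 * y.1 i) * (y.1 i * y.1 j) ∂ν
  have hGi1 : Integrable (fun ω => κ * lam i * ∑ j, lam j * ((θ ω).1 j + (θ ω).2 j) ^ 2) P :=
    (integrable_finsetSum _ fun j _ => (hp j).integrable_sq.const_mul (lam j)).const_mul _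
  have hGi2 : Integrable (fun ω => 2 * τ * ∑ j, c j * ((θ ω).1 j + (θ ω).2 j)) P :=
    (integrable_finsetSum _ fun j _ => ((hp j).integrable one_le_two).const_mul (c j)).const_mul _
  have hGi12 : Integrable (fun ω => κ * lam i * ∑ j, lam j * ((θ ω).1 j + (θ ω).2 j) ^ 2
      - 2 * τ * ∑ j, c j * ((θ ω).1 j + (θ ω).2 j)) P := hGi1.sub hGi2
  have hGi3 : Integrable (fun ω => l ^ 2 *
      (κ * lam i * ∑ j, lam j * ((θ ω).1 j + (θ ω).2 j) ^ 2
        - 2 * τ * (∑ j, c j * ((θ ω).1 j + (θ ω).2 j)) + τ ^ 2 * (σ2 * lam i))) P :=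
    (hGi12.add (integrable_const _)).const_mul _
  have hm := measurable_modePos (α * lam i) (β * lam i) (s + 1)
  have hm' : Measurable fun x : (ι → ℝ) × (ι → ℝ) =>
      modePos (α * lam i) (β * lam i) (s + 1) (x.1 i) (x.2 i) :=
    hm.comp (by fun_prop : Measurable fun x : (ι → ℝ) × (ι → ℝ) => (x.1 i, x.2 i))
  have key := integral_le_of_indepFun hθ hz hind
    (g := fun x => (modePos (α * lam i) (β * lam i) (s + 1) (x.1.1 i) (x.1.2 i) -
      l * (x.2.1 i * (∑ j, x.2.1 j * (x.1.1 j + x.1.2 j) - τ * x.2.2)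
        - lam i * (x.1.1 i + x.1.2 i))) ^ 2)
    (G := fun x => modePos (α * lam i) (β * lam i) (s + 1) (x.1 i) (x.2 i) ^ 2 + l ^ 2 *
      (κ * lam i * ∑ j, lam j * (x.1 j + x.2 j) ^ 2
        - 2 * τ * (∑ j, c j * (x.1 j + x.2 j)) + τ ^ 2 * (σ2 * lam i)))
    (((hm'.comp measurable_fst).sub (by fun_prop)).pow_const 2) hsq
    ((hm'.pow_const 2).add (by fun_prop))
    (hq.integrable_sq.add hGi3)
    (fun x => h.integral_sq_le i (fun j => x.1 j + x.2 j)
      (modePos (α * lam i) (β * lam i) (s + 1) (x.1 i) (x.2 i)) l τ)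
  refine key.trans (le_of_eq ?_)
  -- The mixed moments `c j` of noise and features are uncontrolled; the cross term vanishes only
  -- because `h0` forces either zero noise or a centred position.
  have hc0 : 2 * τ * ∑ j, c j * ∫ ω, ((θ ω).1 j + (θ ω).2 j) ∂P = 0 := by
    rw [Finset.mul_sum]
    refine Finset.sum_eq_zero fun j _ => ?_
    calc _ = 2 * c j * (τ * ∫ ω, ((θ ω).1 j + (θ ω).2 j) ∂P) := by ring
      _ = 0 := by rw [h0, mul_zero]
  rw [integral_add hq.integrable_sq hGi3, integral_const_mul,
    integral_add hGi12 (integrable_const _), integral_sub hGi1 hGi2, integral_const_mul,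
    integral_const_mul,
    integral_finsetSum _ fun j _ => (hp j).integrable_sq.const_mul (lam j),
    integral_finsetSum _ fun j _ => ((hp j).integrable one_le_two).const_mul (c j)]
  simp only [integral_const_mul, integral_const, probReal_univ, smul_eq_mul, one_mul]
  rw [hc0]
  ring

end Step

/-! ### Solving the recursion for bias and variance. -/

/-- A discrete Volterra inequality whose kernel has total mass `K` with `κ K ≤ 2 / 3`. -/
lemma volterra_bound {Φ : ℕ → ℕ → ℝ} {k g : ℕ → ℝ} {κ B G K : ℝ} {T : ℕ} (hκ : 0 ≤ κ)
    (hG : 0 ≤ G) (hC : 0 ≤ B + K * G) (hk : ∀ s, 0 ≤ k s)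
    (hstep : ∀ t s, Φ (t + 1) s ≤ Φ t (s + 1) + k s * (κ * Φ t 0 + g t))
    (hB : ∀ s ≤ T, Φ 0 s ≤ B) (hg : ∀ t < T, g t ≤ G)
    (hK : ∀ n, ∑ s ∈ Finset.range n, k s ≤ K) (hκK : κ * K ≤ 2 / 3) :
    ∀ t ≤ T, Φ t 0 ≤ 3 * (B + K * G) := by
  intro t
  induction t using Nat.strong_induction_on with
  | _ t ih =>
    intro htT
    set C := 3 * (B + K * G) with hCdef
    -- Descends along the antidiagonal to `Φ 0 t`, bounding each earlier `Φ _ 0` by `C`. The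
    -- induction closes since `B + K (κ C + G) ≤ C / 3 + 2 C / 3`.
    have unroll : ∀ j ≤ t, Φ t 0 ≤ Φ (t - j) j + (∑ s ∈ Finset.range j, k s) * (κ * C + G) := by
      intro j
      induction j with
      | zero => intro _; simp
      | succ j ihj =>
        intro hj
        have h1 := ihj (by omega)
        have h2 := hstep (t - (j + 1)) j
        rw [show t - (j + 1) + 1 = t - j by omega] at h2
        have h3 : k j * (κ * Φ (t - (j + 1)) 0 + g (t - (j + 1))) ≤ k j * (κ * C + G) :=
          mul_le_mul_of_nonneg_left (add_le_add
            (mul_le_mul_of_nonneg_left (ih _ (by omega) (by omega)) hκ) (hg _ (by omega))) (hk j)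
        rw [Finset.sum_range_succ, add_mul]
        linarith
    have h := unroll t le_rfl
    rw [Nat.sub_self] at h
    have hB' := hB t htT
    have hC0 : 0 ≤ C := by positivity
    have h4 := mul_le_mul_of_nonneg_right (hK t) (add_nonneg (mul_nonneg hκ hC0) hG)
    have h5 := mul_le_mul_of_nonneg_right hκK hC0
    nlinarith

section Recursion

variable {ι : Type*} [Fintype ι] [DecidableEq ι] {ν : Measure ((ι → ℝ) × ℝ)}
  {lam : ι → ℝ} {κ σ2 : ℝ} {Ω : Type*} [MeasurableSpace Ω] {P : Measure Ω}
  {ζ : ℕ → Ω → (ι → ℝ) × ℝ} [IsProbabilityMeasure P]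

lemma ModeMoments.memLp_modeState (h : ModeMoments ν lam κ σ2) (hζ : ∀ n, HasLaw (ζ n) ν P)
    (hind : iIndepFun ζ P) (α β : ℝ) (τ : ℕ → ℝ) (w : ι → ℝ) (t : ℕ) :
    (∀ i, MemLp (fun ω => (modeState α β τ w (fun n => ζ n ω) t).1 i) 2 P) ∧
      ∀ i, MemLp (fun ω => (modeState α β τ w (fun n => ζ n ω) t).2 i) 2 P := by
  induction t with
  | zero => exact ⟨fun i => memLp_const _, fun i => memLp_const _⟩
  | succ t ih =>
    have hr := h.memLp_residual (hζ t)
      (indepFun_modeState (fun n => (hζ n).aemeasurable) hind α β τ w t) ih.1 ih.2 (τ t)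
    exact ⟨fun i => ((ih.1 i).add (ih.2 i)).sub ((hr i).const_mul β),
      fun i => (ih.2 i).sub ((hr i).const_mul α)⟩

/-- Each update is linear in state and noise, and the noise is uncorrelated with the features, so an
error started at zero stays centred. This removes the cross term from the variance part. -/
lemma ModeMoments.integral_modeState_eq_zero (h : ModeMoments ν lam κ σ2)
    (hζ : ∀ n, HasLaw (ζ n) ν P) (hind : iIndepFun ζ P) (α β : ℝ) (τ : ℕ → ℝ) (t : ℕ) :
    (∀ i, ∫ ω, (modeState α β τ 0 (fun n => ζ n ω) t).1 i ∂P = 0) ∧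
      ∀ i, ∫ ω, (modeState α β τ 0 (fun n => ζ n ω) t).2 i ∂P = 0 := by
  induction t with
  | zero => simp [modeState]
  | succ t ih =>
    have hm := h.memLp_modeState hζ hind α β τ 0 t
    have hI := indepFun_modeState (fun n => (hζ n).aemeasurable) hind α β τ 0 t
    have hr := fun i => (h.memLp_residual (hζ t) hI hm.1 hm.2 (τ t) i).integrable one_le_two
    have h1 := fun i => (hm.1 i).integrable one_le_two
    have h2 := fun i => (hm.2 i).integrable one_le_two
    have h0 := h.integral_residual (hζ t) hI hm.1 hm.2
      (fun j => by rw [integral_add (h1 j) (h2 j), ih.1, ih.2, add_zero]) (τ t)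
    simp only [modeState, modeStep]
    have h12 := fun i => (h1 i).add (h2 i)
    simp only [Pi.add_def] at h12
    exact ⟨fun i => by
        rw [integral_sub (h12 i) ((hr i).const_mul β), integral_add (h1 i) (h2 i), ih.1, ih.2,
          integral_const_mul, h0, mul_zero, add_zero, sub_zero],
      fun i => by
        rw [integral_sub (h2 i) ((hr i).const_mul α), ih.2, integral_const_mul, h0, mul_zero,
          sub_zero]⟩

/-- Second moment bound for the state of accelerated SGD in coordinates. -/
lemma ModeMoments.sum_integral_sq_le [IsProbabilityMeasure ν] (h : ModeMoments ν lam κ σ2)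
    (hζ : ∀ n, HasLaw (ζ n) ν P) (hind : iIndepFun ζ P) {α β : ℝ} (hα : 0 < α) (hβ : 0 < β)
    (hlam : ∀ i, 0 < lam i) (hstep : ∀ i, (α + 2 * β) * lam i ≤ 1) (hκ : 0 ≤ κ)
    (hσ : 0 ≤ σ2)
    (hK : κ * (((α + 2 * β) * ∑ i, lam i + 2 * α * Fintype.card ι / β) / 3) ≤ 2 / 3)
    (τ : ℕ → ℝ) (w : ι → ℝ)
    (h0 : ∀ t j, τ t * ∫ ω, ((modeState α β τ w (fun n => ζ n ω) t).1 j +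
      (modeState α β τ w (fun n => ζ n ω) t).2 j) ∂P = 0)
    {T : ℕ} {B S : ℝ} (hB0 : 0 ≤ B) (hS0 : 0 ≤ S)
    (hB : ∀ s ≤ T, ∑ i, lam i * modePos (α * lam i) (β * lam i) s 0 (w i) ^ 2 ≤ B)
    (hS : ∀ t < T, τ t ^ 2 ≤ S) :
    ∑ i, lam i * ∫ ω, ((modeState α β τ w (fun n => ζ n ω) T).1 i +
      (modeState α β τ w (fun n => ζ n ω) T).2 i) ^ 2 ∂P ≤
      3 * B + ((α + 2 * β) * ∑ i, lam i + 2 * α * Fintype.card ι / β) * (S * σ2) := by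
  set K := ((α + 2 * β) * ∑ i, lam i + 2 * α * Fintype.card ι / β) / 3 with hKdef
  have hK0 : 0 ≤ K := by
    have : 0 ≤ ∑ i, lam i := Finset.sum_nonneg fun i _ => (hlam i).le
    positivity
  have main := volterra_bound (Φ := fun t s => ∑ i, lam i *
      ∫ ω, modePos (α * lam i) (β * lam i) s ((modeState α β τ w (fun n => ζ n ω) t).1 i)
        ((modeState α β τ w (fun n => ζ n ω) t).2 i) ^ 2 ∂P)
    (k := fun s => ∑ i, (lam i * modePos (α * lam i) (β * lam i) s β α) ^ 2)
    (g := fun t => τ t ^ 2 * σ2) (κ := κ) (B := B) (G := S * σ2) (K := K) (T := T) hκ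
    (mul_nonneg hS0 hσ) (by positivity) (fun s => Finset.sum_nonneg fun i _ => sq_nonneg _)
    (fun t s => ?_) (fun s hs => ?_)
    (fun t ht => mul_le_mul_of_nonneg_right (hS t ht) hσ) (fun n => ?_) hK T le_rfl
  · refine main.trans (le_of_eq ?_)
    rw [hKdef]; ring
  · have hm := h.memLp_modeState hζ hind α β τ w t
    rw [Finset.sum_mul, ← Finset.sum_add_distrib]
    refine Finset.sum_le_sum fun i _ => ?_
    have := h.integral_modePos_sq_le
      (aemeasurable_modeState (fun n => (hζ n).aemeasurable) α β τ w t) (hζ t)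
      (indepFun_modeState (fun n => (hζ n).aemeasurable) hind α β τ w t) hm.1 hm.2 α β (τ t)
      (h0 t) s i
    refine (mul_le_mul_of_nonneg_left this (hlam i).le).trans (le_of_eq ?_)
    simp only [modePos]
    ring
  · refine le_trans (le_of_eq ?_) (hB s hs)
    simp [modeState]
  · rw [Finset.sum_comm]
    have : ∀ i, ∑ s ∈ Finset.range n, (lam i * modePos (α * lam i) (β * lam i) s β α) ^ 2 ≤
        (2 * (α / β) + (α + 2 * β) * lam i) / 3 := fun i => by
      simp only [← modePos_mul_impulse]
      refine (sum_modePos_sq_le (mul_pos hα (hlam i)) (mul_pos hβ (hlam i))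
        (by linarith [hstep i]) n).trans (le_of_eq ?_)
      -- The ratio `a / b = α / β` is the same for all modes, so summing it produces the dimension.
      rw [mul_div_mul_right _ _ (hlam i).ne']
      ring
    refine (Finset.sum_le_sum fun i _ => this i).trans (le_of_eq ?_)
    rw [← Finset.sum_div, Finset.sum_add_distrib, hKdef, Finset.mul_sum]
    simp only [Finset.sum_const, Finset.card_univ, nsmul_eq_mul]
    ring

/-- The contribution of the initial error. -/
lemma ModeMoments.bias_le [IsProbabilityMeasure ν] (h : ModeMoments ν lam κ σ2)
    (hζ : ∀ n, HasLaw (ζ n) ν P) (hind : iIndepFun ζ P) {α β : ℝ} (hα : 0 < α) (hβ : 0 < β)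
    (hlam : ∀ i, 0 < lam i) (hstep : ∀ i, (α + 2 * β) * lam i ≤ 1) (hαβ : α ≤ β) (hκ : 0 ≤ κ)
    (hσ : 0 ≤ σ2)
    (hK : κ * (((α + 2 * β) * ∑ i, lam i + 2 * α * Fintype.card ι / β) / 3) ≤ 2 / 3)
    (w : ι → ℝ) (T : ℕ) :
    ∑ i, lam i * ∫ ω, ((modeState α β 0 w (fun n => ζ n ω) T).1 i +
      (modeState α β 0 w (fun n => ζ n ω) T).2 i) ^ 2 ∂P ≤
      3 * (min (1 / α) ((T + 1) / β) * ∑ i, w i ^ 2) := by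
  have hw : 0 ≤ ∑ i, w i ^ 2 := Finset.sum_nonneg fun i _ => sq_nonneg _
  have hmin : 0 ≤ min (1 / α) ((T + 1) / β) := le_min (by positivity) (by positivity)
  refine (h.sum_integral_sq_le hζ hind hα hβ hlam hstep hκ hσ hK 0 w (by simp) (T := T)
    (mul_nonneg hmin hw) le_rfl (fun s hs => ?_) (by simp)).trans (le_of_eq (by ring))
  rw [Finset.mul_sum]
  refine Finset.sum_le_sum fun i _ => ?_
  have ha : 0 < α * lam i := mul_pos hα (hlam i)
  have hb : 0 < β * lam i := mul_pos hβ (hlam i)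
  have hs1 := hstep i
  have hab : α * lam i ≤ β * lam i := mul_le_mul_of_nonneg_right hαβ (hlam i).le
  have hb1 : β * lam i ≤ 1 := by nlinarith
  have hdis : α * lam i ≤ 2 * (β * lam i) - (β * lam i) ^ 2 := by nlinarith
  rw [min_mul_of_nonneg _ _ (sq_nonneg (w i))]
  refine le_min ?_ ?_
  · rw [one_div_mul_eq_div, le_div_iff₀ hα]
    refine le_trans (le_of_eq ?_) (modePos_sq_le ha.le (by linarith) hdis s (w i))
    ring
  · rw [div_mul_eq_mul_div, le_div_iff₀ hβ]
    refine le_trans (le_of_eq ?_) ((mul_modePos_sq_le ha.le hb.le hb1 hdis s (w i)).trans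
      (mul_le_mul_of_nonneg_right ?_ (sq_nonneg _)))
    · ring
    · have : (s : ℝ) ≤ T := by exact_mod_cast hs
      linarith

/-- The contribution of the noise. -/
lemma ModeMoments.variance_le [IsProbabilityMeasure ν] (h : ModeMoments ν lam κ σ2)
    (hζ : ∀ n, HasLaw (ζ n) ν P) (hind : iIndepFun ζ P) {α β : ℝ} (hα : 0 < α) (hβ : 0 < β)
    (hlam : ∀ i, 0 < lam i) (hstep : ∀ i, (α + 2 * β) * lam i ≤ 1) (hκ : 0 ≤ κ)
    (hσ : 0 ≤ σ2)
    (hK : κ * (((α + 2 * β) * ∑ i, lam i + 2 * α * Fintype.card ι / β) / 3) ≤ 2 / 3) (T : ℕ) :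
    ∑ i, lam i * ∫ ω, ((modeState α β (fun t => (t : ℝ) + 1) 0 (fun n => ζ n ω) T).1 i +
      (modeState α β (fun t => (t : ℝ) + 1) 0 (fun n => ζ n ω) T).2 i) ^ 2 ∂P ≤
      ((α + 2 * β) * ∑ i, lam i + 2 * α * Fintype.card ι / β) * ((T : ℝ) ^ 2 * σ2) := by
  have hz := h.integral_modeState_eq_zero hζ hind α β (fun t => (t : ℝ) + 1)
  have hm := h.memLp_modeState hζ hind α β (fun t => (t : ℝ) + 1) 0
  refine (h.sum_integral_sq_le hζ hind hα hβ hlam hstep hκ hσ hK _ 0 (fun t j => ?_) (T := T)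
    (B := 0) (S := (T : ℝ) ^ 2) le_rfl (sq_nonneg _) (fun s hs => ?_) (fun t ht => ?_)).trans
    (le_of_eq (by ring))
  · rw [integral_add (((hm t).1 j).integrable one_le_two) (((hm t).2 j).integrable one_le_two),
      (hz t).1, (hz t).2, add_zero, mul_zero]
  · simp only [Pi.zero_apply, modePos_eq _ _ s 0 0]
    simp
  -- Only noises injected before time `T` matter, and they have magnitude at most `T`.
  · have : (t : ℝ) + 1 ≤ T := by exact_mod_cast ht
    exact pow_le_pow_left₀ (by positivity) this 2

/-- Superposition: for fixed features the recursion is linear in the pair of initial error and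
noise. -/
lemma modeState_add {ι : Type*} [Fintype ι] (α β : ℝ) (τ : ℕ → ℝ) (w : ι → ℝ)
    (z : ℕ → (ι → ℝ) × ℝ) (t : ℕ) :
    modeState α β τ w z t = modeState α β 0 w z t + modeState α β τ 0 z t := by
  induction t with
  | zero => simp [modeState]
  | succ t ih =>
    simp only [modeState, ih, modeStep]
    ext i <;> simp [mul_add, Finset.sum_add_distrib] <;> ring

/-- Second moments of the rescaled error, with both contributions. -/
lemma ModeMoments.total_le [IsProbabilityMeasure ν] (h : ModeMoments ν lam κ σ2)
    (hζ : ∀ n, HasLaw (ζ n) ν P) (hind : iIndepFun ζ P) {α β : ℝ} (hα : 0 < α) (hβ : 0 < β)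
    (hlam : ∀ i, 0 < lam i) (hstep : ∀ i, (α + 2 * β) * lam i ≤ 1) (hαβ : α ≤ β) (hκ : 0 ≤ κ)
    (hσ : 0 ≤ σ2)
    (hK : κ * (((α + 2 * β) * ∑ i, lam i + 2 * α * Fintype.card ι / β) / 3) ≤ 2 / 3)
    (w : ι → ℝ) (T : ℕ) :
    ∑ i, lam i * ∫ ω, ((modeState α β (fun t => (t : ℝ) + 1) w (fun n => ζ n ω) T).1 i +
      (modeState α β (fun t => (t : ℝ) + 1) w (fun n => ζ n ω) T).2 i) ^ 2 ∂P ≤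
      2 * (3 * (min (1 / α) ((T + 1) / β) * ∑ i, w i ^ 2)) +
      2 * (((α + 2 * β) * ∑ i, lam i + 2 * α * Fintype.card ι / β) * ((T : ℝ) ^ 2 * σ2)) := by
  refine le_trans ?_ (add_le_add
    (mul_le_mul_of_nonneg_left (h.bias_le hζ hind hα hβ hlam hstep hαβ hκ hσ hK w T) zero_le_two)
    (mul_le_mul_of_nonneg_left (h.variance_le hζ hind hα hβ hlam hstep hκ hσ hK T) zero_le_two))
  rw [Finset.mul_sum, Finset.mul_sum, ← Finset.sum_add_distrib]
  refine Finset.sum_le_sum fun i _ => ?_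
  have hp : ∀ (τ : ℕ → ℝ) (w : ι → ℝ), Integrable (fun ω =>
      ((modeState α β τ w (fun n => ζ n ω) T).1 i +
        (modeState α β τ w (fun n => ζ n ω) T).2 i) ^ 2) P := fun τ w =>
    (((h.memLp_modeState hζ hind α β τ w T).1 i).add
      ((h.memLp_modeState hζ hind α β τ w T).2 i)).integrable_sq
  rw [mul_left_comm 2, mul_left_comm 2, ← mul_add, ← integral_const_mul (2 : ℝ),
    ← integral_const_mul (2 : ℝ),
    ← integral_add ((hp _ _).const_mul 2) ((hp _ _).const_mul 2)]
  refine mul_le_mul_of_nonneg_left (integral_mono (hp _ _)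
    (((hp _ _).const_mul 2).add ((hp _ _).const_mul 2)) fun ω => ?_) (hlam i).le
  rw [modeState_add]
  simp only [Prod.fst_add, Prod.snd_add, Pi.add_apply]
  nlinarith [sq_nonneg ((modeState α β 0 w (fun n => ζ n ω) T).1 i +
    (modeState α β 0 w (fun n => ζ n ω) T).2 i -
    ((modeState α β (fun t => (t : ℝ) + 1) 0 (fun n => ζ n ω) T).1 i +
    (modeState α β (fun t => (t : ℝ) + 1) 0 (fun n => ζ n ω) T).2 i))]

end Recursion

/-! ### Loewner conditions in the eigenbasis of the covariance. -/

section Coordinates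

variable {d : ℕ} {ρ : Measure (EuclideanSpace ℝ (Fin d) × ℝ)}

lemma inner_eq_sum_mul (x y : EuclideanSpace ℝ (Fin d)) : inner ℝ x y = ∑ i, x i * y i := by
  simp [PiLp.inner_apply, mul_comm]

lemma mul_inner_mul_inner_eq (c : ℝ) (x y a : EuclideanSpace ℝ (Fin d)) :
    c * (inner ℝ x a * inner ℝ y a) = ∑ i, ∑ j, x i * y j * (c * (a i * a j)) := by
  rw [inner_eq_sum_mul, inner_eq_sum_mul, Finset.sum_mul_sum, Finset.mul_sum]
  refine Finset.sum_congr rfl fun i _ => ?_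
  rw [Finset.mul_sum]
  exact Finset.sum_congr rfl fun j _ => by ring

lemma WeightedCovFinite.integrable {w : EuclideanSpace ℝ (Fin d) × ℝ → ℝ}
    (hw : WeightedCovFinite ρ w) (x y : EuclideanSpace ℝ (Fin d)) :
    Integrable (fun p => w p * (inner ℝ x p.1 * inner ℝ y p.1)) ρ := by
  simp only [mul_inner_mul_inner_eq]
  exact integrable_finsetSum _ fun i _ => integrable_finsetSum _ fun j _ => (hw i j).const_mul _

lemma WeightedCovFinite.dotProduct_mulVec {w : EuclideanSpace ℝ (Fin d) × ℝ → ℝ}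
    (hw : WeightedCovFinite ρ w) (x y : EuclideanSpace ℝ (Fin d)) :
    x.ofLp ⬝ᵥ (weightedCov ρ w).mulVec y.ofLp =
      ∫ p, w p * (inner ℝ x p.1 * inner ℝ y p.1) ∂ρ := by
  simp only [mul_inner_mul_inner_eq]
  rw [integral_finsetSum _ fun i _ => integrable_finsetSum _ fun j _ => (hw i j).const_mul _]
  refine Finset.sum_congr rfl fun i _ => ?_
  rw [integral_finsetSum _ fun j _ => (hw i j).const_mul _, Matrix.mulVec, dotProduct,
    Finset.mul_sum]
  refine Finset.sum_congr rfl fun j _ => ?_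
  rw [integral_const_mul]
  simp only [weightedCov, Matrix.of_apply]
  ring

lemma weightedCov_one : weightedCov ρ (fun _ => 1) = covMatrix ρ := by
  simp [weightedCov, covMatrix]

lemma isHermitian_covMatrix : (covMatrix ρ).IsHermitian := by
  ext i j
  simp [covMatrix, mul_comm]

lemma memLp_inner (ha : Integrable (fun p => ‖p.1‖ ^ 2) ρ) (x : EuclideanSpace ℝ (Fin d)) :
    MemLp (fun p : EuclideanSpace ℝ (Fin d) × ℝ => (inner ℝ x p.1 : ℝ)) 2 ρ := by
  have hn : MemLp (fun p : EuclideanSpace ℝ (Fin d) × ℝ => p.1) 2 ρ :=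
    (memLp_two_iff_integrable_sq_norm (by fun_prop)).2 ha
  exact hn.const_inner x

lemma weightedCovFinite_one (ha : Integrable (fun p => ‖p.1‖ ^ 2) ρ) :
    WeightedCovFinite ρ (fun _ => 1) := by
  intro i j
  have h : ∀ i : Fin d, MemLp (fun p : EuclideanSpace ℝ (Fin d) × ℝ => p.1 i) 2 ρ := fun i => by
    have := memLp_inner ha (EuclideanSpace.single i 1)
    simp only [inner_eq_sum_mul] at this
    simpa using this
  simpa [Pi.mul_def] using (h i).integrable_mul (h j)

/-- Testing a Loewner bound between weighted covariances on a vector. -/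
lemma integral_le_of_posSemidef (ha : Integrable (fun p => ‖p.1‖ ^ 2) ρ) {c : ℝ}
    {w : EuclideanSpace ℝ (Fin d) × ℝ → ℝ} (hw : WeightedCovFinite ρ w)
    (h : (c • covMatrix ρ - weightedCov ρ w).PosSemidef) (x : EuclideanSpace ℝ (Fin d)) :
    ∫ p, w p * (inner ℝ x p.1 * inner ℝ x p.1) ∂ρ ≤
      c * ∫ p, inner ℝ x p.1 * inner ℝ x p.1 ∂ρ := by
  have h1 := h.dotProduct_mulVec_nonneg x.ofLp
  rw [star_trivial, Matrix.sub_mulVec, dotProduct_sub, Matrix.smul_mulVec, dotProduct_smul,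
    ← weightedCov_one, (weightedCovFinite_one ha).dotProduct_mulVec, hw.dotProduct_mulVec] at h1
  simp only [one_mul, smul_eq_mul] at h1
  linarith

lemma covMatrix_integral_inner (ha : Integrable (fun p => ‖p.1‖ ^ 2) ρ) (i j : Fin d) :
    ∫ p, inner ℝ ((isHermitian_covMatrix (ρ := ρ)).eigenvectorBasis i) p.1 *
      inner ℝ ((isHermitian_covMatrix (ρ := ρ)).eigenvectorBasis j) p.1 ∂ρ =
      if i = j then (isHermitian_covMatrix (ρ := ρ)).eigenvalues i else 0 := by
  set hH := isHermitian_covMatrix (ρ := ρ)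
  have h := (weightedCovFinite_one ha).dotProduct_mulVec (hH.eigenvectorBasis i)
    (hH.eigenvectorBasis j)
  simp only [one_mul] at h
  rw [← h, weightedCov_one, hH.mulVec_eigenvectorBasis, dotProduct_smul]
  have := hH.eigenvectorBasis.inner_eq_ite i j
  rw [inner_eq_sum_mul] at this
  rw [dotProduct, this]
  split_ifs with hij
  · simp [hij]
  · simp

lemma eigenvalues_covMatrix_pos (ha : Integrable (fun p => ‖p.1‖ ^ 2) ρ)
    (hH : IsUnit (covMatrix ρ)) (i : Fin d) :
    0 < (isHermitian_covMatrix (ρ := ρ)).eigenvalues i := by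
  have hne : (isHermitian_covMatrix (ρ := ρ)).eigenvalues i ≠ 0 := by
    intro h0
    have hdet := (Matrix.isUnit_iff_isUnit_det _).1 hH
    rw [(isHermitian_covMatrix (ρ := ρ)).det_eq_prod_eigenvalues] at hdet
    exact hdet.ne_zero (Finset.prod_eq_zero (Finset.mem_univ i) (by simp [h0]))
  have h := covMatrix_integral_inner ha i i
  rw [if_pos rfl] at h
  refine lt_of_le_of_ne ?_ hne.symm
  rw [← h]
  exact integral_nonneg fun p => mul_self_nonneg _

lemma trace_covMatrix :
    (covMatrix ρ).trace = ∑ i, (isHermitian_covMatrix (ρ := ρ)).eigenvalues i := by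
  simpa using (isHermitian_covMatrix (ρ := ρ)).trace_eq_sum_eigenvalues

lemma inner_vecMulVec_self (x a : EuclideanSpace ℝ (Fin d)) :
    inner ℝ a ((Matrix.vecMulVec x.ofLp x.ofLp).toEuclideanLin a) =
      inner ℝ x a * inner ℝ x a := by
  have : (Matrix.vecMulVec x.ofLp x.ofLp).toEuclideanLin a = (inner ℝ x a : ℝ) • x := by
    ext i
    rw [inner_eq_sum_mul]
    simp [Matrix.mulVec, dotProduct, Matrix.vecMulVec_apply, Finset.mul_sum, mul_comm (∑ _, _),
      mul_assoc]
  rw [this, inner_smul_right, real_inner_comm a x]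

/-- The kurtosis condition along a direction. -/
lemma UniformKurtosis.integral_le {κ : ℝ} (hκ : UniformKurtosis ρ κ)
    (ha : Integrable (fun p => ‖p.1‖ ^ 2) ρ) (x y : EuclideanSpace ℝ (Fin d)) :
    WeightedCovFinite ρ (fun p => inner ℝ x p.1 * inner ℝ x p.1) ∧
    ∫ p, (inner ℝ x p.1 * inner ℝ x p.1) * (inner ℝ y p.1 * inner ℝ y p.1) ∂ρ ≤
      κ * (∫ p, inner ℝ x p.1 * inner ℝ x p.1 ∂ρ) *
        ∫ p, inner ℝ y p.1 * inner ℝ y p.1 ∂ρ := by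
  -- The rank-one matrix `x ⊗ x` turns `⟨a, M a⟩` into `⟨x, a⟩²` and the trace into `⟨x, H x⟩`.
  obtain ⟨h1, h2⟩ := hκ (Matrix.vecMulVec x.ofLp x.ofLp)
    (by simpa using Matrix.posSemidef_vecMulVec_self_star x.ofLp)
  simp only [inner_vecMulVec_self] at h1 h2
  refine ⟨h1, ?_⟩
  have h3 := integral_le_of_posSemidef ha h1 h2 y
  rwa [Matrix.vecMulVec_mul, Matrix.trace_vecMulVec, dotProduct_comm, ← Matrix.dotProduct_mulVec,
    ← weightedCov_one, (weightedCovFinite_one ha).dotProduct_mulVec x x, funext fun _ => one_mul _]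
    at h3

end Coordinates

/-! ### Excess risk as a quadratic form. -/

section Risk

variable {d : ℕ} {ρ : Measure (EuclideanSpace ℝ (Fin d) × ℝ)}

lemma memLp_residual_noise (ha : Integrable (fun p => ‖p.1‖ ^ 2) ρ)
    (hb : Integrable (fun p => p.2 ^ 2) ρ) (x : EuclideanSpace ℝ (Fin d)) :
    MemLp (fun p : EuclideanSpace ℝ (Fin d) × ℝ => p.2 - inner ℝ x p.1) 2 ρ :=
  ((memLp_two_iff_integrable_sq (by fun_prop)).2 hb).sub (memLp_inner ha x)

lemma risk_add (ha : Integrable (fun p => ‖p.1‖ ^ 2) ρ)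
    (hb : Integrable (fun p => p.2 ^ 2) ρ) (x h : EuclideanSpace ℝ (Fin d)) :
    risk ρ (x + h) = risk ρ x - ∫ p, (p.2 - inner ℝ x p.1) * inner ℝ h p.1 ∂ρ
      + 1 / 2 * ∫ p, inner ℝ h p.1 * inner ℝ h p.1 ∂ρ := by
  have hE := memLp_residual_noise ha hb x
  have hh := memLp_inner ha h
  have e : (fun p : EuclideanSpace ℝ (Fin d) × ℝ => (inner ℝ (x + h) p.1 - p.2) ^ 2) =
      (fun p => (inner ℝ x p.1 - p.2) ^ 2)
        + (fun p => (-2) * ((p.2 - inner ℝ x p.1) * inner ℝ h p.1))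
        + fun p => inner ℝ h p.1 * inner ℝ h p.1 := by
    ext p; simp only [Pi.add_apply, inner_add_left]; ring
  have i1 : Integrable (fun p : EuclideanSpace ℝ (Fin d) × ℝ => (inner ℝ x p.1 - p.2) ^ 2) ρ := by
    refine hE.integrable_sq.congr (ae_of_all _ fun p => ?_)
    simp only; ring
  have i2 : Integrable (fun p : EuclideanSpace ℝ (Fin d) × ℝ =>
      (-2) * ((p.2 - inner ℝ x p.1) * inner ℝ h p.1)) ρ := (hE.integrable_mul hh).const_mul _
  have i3 : Integrable (fun p : EuclideanSpace ℝ (Fin d) × ℝ =>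
      inner ℝ h p.1 * inner ℝ h p.1) ρ := hh.integrable_mul hh
  unfold risk
  rw [e, integral_add' (i1.add i2) i3, integral_add' i1 i2, integral_const_mul]
  ring

/-- First-order optimality of a minimizer of the risk. -/
lemma integral_noise_mul_inner_eq_zero (ha : Integrable (fun p => ‖p.1‖ ^ 2) ρ)
    (hb : Integrable (fun p => p.2 ^ 2) ρ) {xstar : EuclideanSpace ℝ (Fin d)}
    (hmin : ∀ x, risk ρ xstar ≤ risk ρ x) (h : EuclideanSpace ℝ (Fin d)) :
    ∫ p, (p.2 - inner ℝ xstar p.1) * inner ℝ h p.1 ∂ρ = 0 := by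
  set l := ∫ p, (p.2 - inner ℝ xstar p.1) * inner ℝ h p.1 ∂ρ with hl
  set A := ∫ p, (inner ℝ h p.1 * inner ℝ h p.1 : ℝ) ∂ρ with hA
  have hA0 : 0 ≤ A := integral_nonneg fun p => mul_self_nonneg _
  have key : ∀ s : ℝ, s * l ≤ 1 / 2 * (s * s * A) := by
    intro s
    have h1 := hmin (xstar + s • h)
    rw [risk_add ha hb] at h1
    have e1 : ∫ p, (p.2 - inner ℝ xstar p.1) * inner ℝ (s • h) p.1 ∂ρ = s * l := by
      rw [hl, ← integral_const_mul]
      congr 1 with p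
      rw [real_inner_smul_left]; ring
    have e2 : ∫ p, (inner ℝ (s • h) p.1 * inner ℝ (s • h) p.1 : ℝ) ∂ρ = s * s * A := by
      rw [hA, ← integral_const_mul]
      congr 1 with p
      rw [real_inner_smul_left]; ring
    rw [e1, e2] at h1
    linarith
  -- A near-optimal step along `h`; the `+ 1` covers the case `A = 0`.
  have hk := key (l / (A + 1))
  have hpos : 0 < A + 1 := by linarith
  have h2 : l ^ 2 * (A + 2) ≤ 0 := by
    have := mul_le_mul_of_nonneg_right hk (mul_pos hpos hpos).le
    have e1 : l / (A + 1) * l * ((A + 1) * (A + 1)) = l ^ 2 * (A + 1) := by field_simp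
    have e2 : 1 / 2 * (l / (A + 1) * (l / (A + 1)) * A) * ((A + 1) * (A + 1)) =
        1 / 2 * (l ^ 2 * A) := by field_simp
    rw [e1, e2] at this
    nlinarith
  have h3 : l ^ 2 ≤ 0 := by nlinarith [mul_nonneg (sq_nonneg l) hA0]
  exact pow_eq_zero_iff two_ne_zero |>.1 (le_antisymm h3 (sq_nonneg l))

lemma sum_coord_mul_inner (y a : EuclideanSpace ℝ (Fin d))
    (e : OrthonormalBasis (Fin d) ℝ (EuclideanSpace ℝ (Fin d))) :
    ∑ i, inner ℝ (e i) a * inner ℝ (e i) y = inner ℝ a y := by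
  rw [← e.sum_inner_mul_inner a y]
  exact Finset.sum_congr rfl fun i _ => by rw [real_inner_comm]

lemma integral_inner_mul_self_eq_sum (ha : Integrable (fun p => ‖p.1‖ ^ 2) ρ)
    (x : EuclideanSpace ℝ (Fin d)) :
    ∫ p, inner ℝ x p.1 * inner ℝ x p.1 ∂ρ =
      ∑ i, (isHermitian_covMatrix (ρ := ρ)).eigenvalues i *
        inner ℝ ((isHermitian_covMatrix (ρ := ρ)).eigenvectorBasis i) x ^ 2 := by
  set e := (isHermitian_covMatrix (ρ := ρ)).eigenvectorBasis
  have hexp : ∀ p : EuclideanSpace ℝ (Fin d) × ℝ, (inner ℝ x p.1 * inner ℝ x p.1 : ℝ) =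
      ∑ i, ∑ j, (inner ℝ (e i) x * inner ℝ (e j) x) *
        (inner ℝ (e i) p.1 * inner ℝ (e j) p.1) := fun p => by
    rw [← sum_coord_mul_inner p.1 x e, Finset.sum_mul_sum]
    exact Finset.sum_congr rfl fun i _ => Finset.sum_congr rfl fun j _ => by ring
  have hi : ∀ i j, Integrable (fun p : EuclideanSpace ℝ (Fin d) × ℝ =>
      (inner ℝ (e i) x * inner ℝ (e j) x) * (inner ℝ (e i) p.1 * inner ℝ (e j) p.1)) ρ :=
    fun i j => ((memLp_inner ha (e i)).integrable_mul (memLp_inner ha (e j))).const_mul _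
  simp only [hexp]
  rw [integral_finsetSum _ fun i _ => integrable_finsetSum _ fun j _ => hi i j]
  refine Finset.sum_congr rfl fun i _ => ?_
  rw [integral_finsetSum _ fun j _ => hi i j]
  simp only [integral_const_mul, e, covMatrix_integral_inner ha]
  simp
  ring

/-- The excess risk in coordinates. -/
lemma risk_eq_add_sum (ha : Integrable (fun p => ‖p.1‖ ^ 2) ρ)
    (hb : Integrable (fun p => p.2 ^ 2) ρ) {xstar : EuclideanSpace ℝ (Fin d)}
    (hmin : ∀ x, risk ρ xstar ≤ risk ρ x) (x : EuclideanSpace ℝ (Fin d)) :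
    risk ρ x = risk ρ xstar + 1 / 2 * ∑ i, (isHermitian_covMatrix (ρ := ρ)).eigenvalues i *
        inner ℝ ((isHermitian_covMatrix (ρ := ρ)).eigenvectorBasis i) (x - xstar) ^ 2 := by
  have h := risk_add ha hb xstar (x - xstar)
  rw [add_sub_cancel, integral_noise_mul_inner_eq_zero ha hb hmin,
    integral_inner_mul_self_eq_sum ha] at h
  linarith

end Risk

/-! ### Passage from the algorithm to the modes. -/

section Samples

variable {d : ℕ}

/-- Features and noise of a sample, in the coordinates of an orthonormal basis. -/
noncomputable def modeSample (e : OrthonormalBasis (Fin d) ℝ (EuclideanSpace ℝ (Fin d)))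
    (xstar : EuclideanSpace ℝ (Fin d)) (p : EuclideanSpace ℝ (Fin d) × ℝ) : (Fin d → ℝ) × ℝ :=
  (fun i => inner ℝ (e i) p.1, p.2 - inner ℝ xstar p.1)

lemma measurable_modeSample (e : OrthonormalBasis (Fin d) ℝ (EuclideanSpace ℝ (Fin d)))
    (xstar : EuclideanSpace ℝ (Fin d)) : Measurable (modeSample e xstar) := by
  unfold modeSample
  refine Measurable.prodMk (measurable_pi_lambda _ fun i => ?_) ?_ <;> fun_prop

/-- Accelerated SGD in coordinates. -/
lemma modeState_modeSample (e : OrthonormalBasis (Fin d) ℝ (EuclideanSpace ℝ (Fin d)))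
    (α β : ℝ) (x₀ xstar : EuclideanSpace ℝ (Fin d)) (s : ℕ → EuclideanSpace ℝ (Fin d) × ℝ)
    (t : ℕ) (i : Fin d) :
    (modeState α β (fun t => (t : ℝ) + 1) (fun i => inner ℝ (e i) (x₀ - xstar))
        (fun n => modeSample e xstar (s n)) t).2 i =
      inner ℝ (e i) ((acsgdState α β x₀ s t).2 - xstar) ∧
    (modeState α β (fun t => (t : ℝ) + 1) (fun i => inner ℝ (e i) (x₀ - xstar))
        (fun n => modeSample e xstar (s n)) t).1 i +
      (modeState α β (fun t => (t : ℝ) + 1) (fun i => inner ℝ (e i) (x₀ - xstar))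
        (fun n => modeSample e xstar (s n)) t).2 i =
      ((t : ℝ) + 1) * inner ℝ (e i) ((acsgdState α β x₀ s t).1 - xstar) := by
  induction t generalizing i with
  | zero => simp [modeState, acsgdState]
  | succ t ih =>
    have ih1 := fun i => (ih i).1
    have ih2 := fun i => (ih i).2
    set x := (acsgdState α β x₀ s t).1 with hx
    set z := (acsgdState α β x₀ s t).2 with hz
    -- The weight `t + 1` of the gradient in the `z` update is also the scaling of `x_t - x⋆`, which
    -- is why the rescaled noise has magnitude `t + 1`.
    have hres : ∑ j, (modeSample e xstar (s t)).1 j *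
        (((t : ℝ) + 1) * inner ℝ (e j) (x - xstar)) -
        ((t : ℝ) + 1) * (modeSample e xstar (s t)).2 =
        ((t : ℝ) + 1) * (inner ℝ (s t).1 x - (s t).2) := by
      have h1 : ∑ j, (modeSample e xstar (s t)).1 j *
          (((t : ℝ) + 1) * inner ℝ (e j) (x - xstar)) =
          ((t : ℝ) + 1) * inner ℝ (s t).1 (x - xstar) := by
        rw [← sum_coord_mul_inner _ _ e, Finset.mul_sum]
        exact Finset.sum_congr rfl fun j _ => by simp only [modeSample]; ring
      rw [h1, inner_sub_right, real_inner_comm xstar]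
      simp only [modeSample]
      ring
    have ht : ((t : ℝ) + 2) ≠ 0 := by positivity
    simp only [modeState, modeStep, ih2, hres, acsgdState, ← hx, ← hz]
    simp only [ih1]
    simp only [stochGrad, inner_sub_right, inner_add_right, inner_smul_right, modeSample]
    refine ⟨by ring, ?_⟩
    push_cast
    field_simp
    ring

end Samples

/-! ### Verification of the moment conditions and conclusion. -/

section Main

variable {d : ℕ} {ρ : Measure (EuclideanSpace ℝ (Fin d) × ℝ)}

lemma memLp_map_iff_modeSample {e : OrthonormalBasis (Fin d) ℝ (EuclideanSpace ℝ (Fin d))}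
    {xstar : EuclideanSpace ℝ (Fin d)} {f : (Fin d → ℝ) × ℝ → ℝ} (hf : Measurable f) :
    MemLp f 2 (ρ.map (modeSample e xstar)) ↔
      Integrable (fun p => f (modeSample e xstar p) ^ 2) ρ := by
  rw [memLp_two_iff_integrable_sq hf.aestronglyMeasurable,
    integrable_map_measure (hf.pow_const 2).aestronglyMeasurable
      (measurable_modeSample e xstar).aemeasurable]
  rfl

/-- The samples satisfy the moment conditions in the eigenbasis of the covariance. -/
lemma modeMoments_modeSample
    (ha : Integrable (fun p => ‖p.1‖ ^ 2) ρ) (hb : Integrable (fun p => p.2 ^ 2) ρ)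
    {xstar : EuclideanSpace ℝ (Fin d)} (hmin : ∀ x, risk ρ xstar ≤ risk ρ x)
    {κ : ℝ} (hκ : UniformKurtosis ρ κ) {σ : ℝ} (hσ : NoiseLevel ρ xstar σ) :
    ModeMoments (ρ.map (modeSample (isHermitian_covMatrix (ρ := ρ)).eigenvectorBasis xstar))
      (isHermitian_covMatrix (ρ := ρ)).eigenvalues κ (σ ^ 2) := by
  set e := (isHermitian_covMatrix (ρ := ρ)).eigenvectorBasis with he
  set lam := (isHermitian_covMatrix (ρ := ρ)).eigenvalues with hlam
  have hm := (measurable_modeSample e xstar).aemeasurable (μ := ρ)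
  have hcov : ∀ i j, ∫ p, (inner ℝ (e i) p.1 * inner ℝ (e j) p.1 : ℝ) ∂ρ =
      if i = j then lam i else 0 := covMatrix_integral_inner ha
  refine ⟨fun i j => ?_, fun i => ?_, fun i j => ?_, fun i => ?_, fun i p => ?_, fun i => ?_⟩
  · rw [memLp_map_iff_modeSample (by fun_prop)]
    refine ((hκ.integral_le ha (e i) (e j)).1.integrable (e j) (e j)).congr
      (ae_of_all _ fun p => ?_)
    simp only [modeSample]; ring
  · rw [memLp_map_iff_modeSample (by fun_prop)]
    refine (hσ.1.integrable (e i) (e i)).congr (ae_of_all _ fun p => ?_)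
    simp only [modeSample]; ring
  · rw [integral_map hm (by fun_prop : Measurable fun z : (Fin d → ℝ) × ℝ =>
      z.1 i * z.1 j).aestronglyMeasurable]
    exact hcov i j
  · rw [integral_map hm (by fun_prop : Measurable fun z : (Fin d → ℝ) × ℝ =>
      z.2 * z.1 i).aestronglyMeasurable]
    exact integral_noise_mul_inner_eq_zero ha hb hmin (e i)
  · rw [integral_map hm (by fun_prop : Measurable fun z : (Fin d → ℝ) × ℝ =>
      (z.1 i * ∑ j, z.1 j * p j) ^ 2).aestronglyMeasurable]
    -- The weight is `⟨e i, a⟩²` and the test vector is the point with coordinates `p`.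
    have hk := (hκ.integral_le ha (e i) (∑ j, p j • e j)).2
    rw [hcov, if_pos rfl, integral_inner_mul_self_eq_sum ha] at hk
    have hinner : ∀ i, inner ℝ (e i) (∑ j, p j • e j) = p i := fun i => by
      simp [inner_sum, inner_smul_right, e.inner_eq_ite]
    simp only [← he, ← hlam, hinner] at hk
    refine le_trans (le_of_eq ?_) hk
    congr 1 with q
    simp only [modeSample, sum_inner, real_inner_smul_left, mul_comm]
    ring
  · rw [integral_map hm (by fun_prop : Measurable fun z : (Fin d → ℝ) × ℝ =>
      (z.2 * z.1 i) ^ 2).aestronglyMeasurable]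
    have hk := integral_le_of_posSemidef ha hσ.1 hσ.2 (e i)
    rw [hcov, if_pos rfl] at hk
    refine le_trans (le_of_eq ?_) hk
    congr 1 with q
    simp only [modeSample]
    ring

lemma excessRiskLE_of_le {Ω : Type*} [MeasurableSpace Ω] {P : Measure Ω}
    {ξ : ℕ → Ω → EuclideanSpace ℝ (Fin d) × ℝ} {x₀ xstar : EuclideanSpace ℝ (Fin d)}
    {α β : ℝ} {t : ℕ} {B B' : ℝ} (h : ExcessRiskLE P ρ ξ x₀ xstar α β t B) (hB : B ≤ B') :
    ExcessRiskLE P ρ ξ x₀ xstar α β t B' := ⟨h.1, h.2.trans hB⟩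

/-- A noiseless problem has noise level zero. -/
lemma noiseLevel_zero {xstar : EuclideanSpace ℝ (Fin d)}
    (h : ∀ᵐ p ∂ρ, p.2 = inner ℝ xstar p.1) : NoiseLevel ρ xstar 0 := by
  have h0 : ∀ i j : Fin d, (fun p : EuclideanSpace ℝ (Fin d) × ℝ =>
      (p.2 - inner ℝ xstar p.1) ^ 2 * (p.1 i * p.1 j)) =ᵐ[ρ] fun _ => 0 := fun i j => by
    filter_upwards [h] with p hp
    simp [hp]
  refine ⟨fun i j => (integrable_zero _ _ _).congr (h0 i j).symm, ?_⟩
  have : weightedCov ρ (fun p => (p.2 - inner ℝ xstar p.1) ^ 2) = 0 := by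
    ext i j
    simp [weightedCov, integral_congr_ae (h0 i j)]
  rw [this]
  simpa using Matrix.PosSemidef.zero

variable [IsProbabilityMeasure ρ]

/-- The kurtosis constant of a nondegenerate distribution is at least one. -/
lemma UniformKurtosis.one_le (hd : 0 < d) (ha : Integrable (fun p => ‖p.1‖ ^ 2) ρ)
    (hH : IsUnit (covMatrix ρ)) {κ : ℝ} (hκ : UniformKurtosis ρ κ) : 1 ≤ κ := by
  let i : Fin d := ⟨0, hd⟩
  set e := (isHermitian_covMatrix (ρ := ρ)).eigenvectorBasis with he
  have hpos := eigenvalues_covMatrix_pos ha hH i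
  set l := (isHermitian_covMatrix (ρ := ρ)).eigenvalues i with hl
  obtain ⟨h1, h2⟩ := hκ.integral_le ha (e i) (e i)
  have h3 : ∫ p, (inner ℝ (e i) p.1 * inner ℝ (e i) p.1 : ℝ) ∂ρ = l := by
    simpa using covMatrix_integral_inner ha i i
  rw [h3] at h2
  have i1 := h1.integrable (e i) (e i)
  have i2 : Integrable (fun p : EuclideanSpace ℝ (Fin d) × ℝ =>
      (inner ℝ (e i) p.1 * inner ℝ (e i) p.1 : ℝ)) ρ :=
    (memLp_inner ha (e i)).integrable_mul (memLp_inner ha (e i))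
  -- With `X = ⟨e i, a⟩`, nonnegativity of the variance of `X²` gives `l² ≤ E X⁴`, while kurtosis
  -- gives `E X⁴ ≤ κ l²`.
  have h4 : 0 ≤ ∫ p, ((inner ℝ (e i) p.1 * inner ℝ (e i) p.1) *
      (inner ℝ (e i) p.1 * inner ℝ (e i) p.1)
      - (2 * l) * (inner ℝ (e i) p.1 * inner ℝ (e i) p.1) + l ^ 2 : ℝ) ∂ρ :=
    integral_nonneg fun p => by
      refine le_of_le_of_eq (sq_nonneg ((inner ℝ (e i) p.1 * inner ℝ (e i) p.1 : ℝ) - l)) ?_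
      ring
  have i3 : Integrable (fun p : EuclideanSpace ℝ (Fin d) × ℝ =>
      ((inner ℝ (e i) p.1 * inner ℝ (e i) p.1) * (inner ℝ (e i) p.1 * inner ℝ (e i) p.1)
      - (2 * l) * (inner ℝ (e i) p.1 * inner ℝ (e i) p.1) : ℝ)) ρ := i1.sub (i2.const_mul _)
  rw [integral_add i3 (integrable_const _), integral_sub i1 (i2.const_mul _), integral_const_mul,
    h3] at h4
  simp only [integral_const, probReal_univ, smul_eq_mul, one_mul] at h4
  by_contra hlt
  nlinarith [mul_pos hpos hpos]

/-- The last-iterate guarantee of accelerated SGD. -/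
lemma excessRiskLE_acsgd (hd : 0 < d)
    (ha : Integrable (fun p => ‖p.1‖ ^ 2) ρ) (hb : Integrable (fun p => p.2 ^ 2) ρ)
    (hH : IsUnit (covMatrix ρ))
    {xstar : EuclideanSpace ℝ (Fin d)} (hmin : ∀ x, risk ρ xstar ≤ risk ρ x)
    {Ω : Type*} [MeasurableSpace Ω] {P : Measure Ω} [IsProbabilityMeasure P]
    {ξ : ℕ → Ω → EuclideanSpace ℝ (Fin d) × ℝ}
    (hlaw : ∀ n, HasLaw (ξ n) ρ P) (hindep : iIndepFun ξ P)
    {κ : ℝ} (hκ : UniformKurtosis ρ κ) (x₀ : EuclideanSpace ℝ (Fin d))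
    {σ : ℝ} (hσ : NoiseLevel ρ xstar σ) {α β : ℝ} (hα : 0 < α) (hβ : 0 < β)
    (htr : κ * (α + 2 * β) * (covMatrix ρ).trace ≤ 1) (hαβ : α ≤ β / (2 * κ * d))
    {t : ℕ} (ht : 1 ≤ t) :
    ExcessRiskLE P ρ ξ x₀ xstar α β t
      (min (3 / (α * (t : ℝ) ^ 2)) (24 / (β * (t : ℝ))) * ‖x₀ - xstar‖ ^ 2
        + 2 * ((α + 2 * β) * (covMatrix ρ).trace + 2 * α * d / β) * σ ^ 2) := by
  -- From `1 ≤ κ` come positivity of the denominator `2 κ d`, the comparison `α ≤ β`, and the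
  -- per-mode stability condition.
  have hκ1 := hκ.one_le hd ha hH
  have hlam := eigenvalues_covMatrix_pos ha hH
  have hM := modeMoments_modeSample ha hb hmin hκ hσ
  have hrisk := fun ω => risk_eq_add_sum ha hb hmin (acsgd α β x₀ (fun n => ξ n ω) t)
  rw [trace_covMatrix] at htr ⊢
  set e := (isHermitian_covMatrix (ρ := ρ)).eigenvectorBasis with he
  set lam := (isHermitian_covMatrix (ρ := ρ)).eigenvalues with hlamdef
  have hms := measurable_modeSample e xstar
  have : IsProbabilityMeasure (ρ.map (modeSample e xstar)) :=
    Measure.isProbabilityMeasure_map hms.aemeasurable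
  have hζ : ∀ n, HasLaw (fun ω => modeSample e xstar (ξ n ω)) (ρ.map (modeSample e xstar)) P :=
    fun n => ⟨hms.comp_aemeasurable (hlaw n).aemeasurable, by
      rw [← (hlaw n).map_eq, AEMeasurable.map_map_of_aemeasurable hms.aemeasurable
        (hlaw n).aemeasurable]; rfl⟩
  have hind : iIndepFun (fun n ω => modeSample e xstar (ξ n ω)) P :=
    hindep.comp (fun _ => modeSample e xstar) fun _ => hms
  have hd1 : (1 : ℝ) ≤ d := by exact_mod_cast hd
  have hκd : 1 ≤ κ * d := one_le_mul_of_one_le_of_one_le hκ1 hd1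
  have hκ2d : 0 < 2 * κ * d := by linarith
  have hαβ1 : α * (2 * κ * d) ≤ β := (le_div_iff₀ hκ2d).1 hαβ
  have hαβ' : α ≤ β := by nlinarith
  have hsum0 : 0 ≤ ∑ i, lam i := Finset.sum_nonneg fun i _ => (hlam i).le
  have hstep : ∀ i, (α + 2 * β) * lam i ≤ 1 := fun i => by
    have h1 : lam i ≤ ∑ i, lam i :=
      Finset.single_le_sum (fun i _ => (hlam i).le) (Finset.mem_univ i)
    have h2 : 0 ≤ (α + 2 * β) * ∑ i, lam i := by positivity
    have h3 : (α + 2 * β) * lam i ≤ (α + 2 * β) * ∑ i, lam i :=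
      mul_le_mul_of_nonneg_left h1 (by positivity)
    nlinarith
  -- Each step-size condition bounds one of the two summands by 1; the division by 3 leaves `2 / 3`.
  have hK : κ * (((α + 2 * β) * ∑ i, lam i + 2 * α * Fintype.card (Fin d) / β) / 3) ≤ 2 / 3 := by
    have h1 : κ * (2 * α * d / β) ≤ 1 := by
      rw [← mul_div_assoc, div_le_one hβ]
      linarith
    rw [Fintype.card_fin]
    linarith
  have htot := hM.total_le hζ hind hα hβ hlam hstep hαβ' (by linarith) (sq_nonneg σ) hK
    (fun i => inner ℝ (e i) (x₀ - xstar)) t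
  have hmem := hM.memLp_modeState hζ hind α β (fun t => (t : ℝ) + 1)
    (fun i => inner ℝ (e i) (x₀ - xstar)) t
  have hcoord : ∀ ω i, ((modeState α β (fun t => (t : ℝ) + 1)
      (fun i => inner ℝ (e i) (x₀ - xstar)) (fun n => modeSample e xstar (ξ n ω)) t).1 i +
      (modeState α β (fun t => (t : ℝ) + 1) (fun i => inner ℝ (e i) (x₀ - xstar))
        (fun n => modeSample e xstar (ξ n ω)) t).2 i) =
      ((t : ℝ) + 1) * inner ℝ (e i) (acsgd α β x₀ (fun n => ξ n ω) t - xstar) := fun ω i =>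
    (modeState_modeSample e α β x₀ xstar (fun n => ξ n ω) t i).2
  have ht1 : (0 : ℝ) < (t : ℝ) + 1 := by positivity
  have hsq : ∀ i, Integrable (fun ω =>
      inner ℝ (e i) (acsgd α β x₀ (fun n => ξ n ω) t - xstar) ^ 2) P := fun i => by
    have h1 := ((hmem.1 i).add (hmem.2 i)).integrable_sq
    simp only [Pi.add_apply, hcoord] at h1
    refine (h1.const_mul (1 / ((t : ℝ) + 1) ^ 2)).congr (ae_of_all _ fun ω => ?_)
    simp only
    field_simp
  have hint : Integrable (fun ω => 1 / 2 * ∑ i, lam i *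
      inner ℝ (e i) (acsgd α β x₀ (fun n => ξ n ω) t - xstar) ^ 2) P :=
    (integrable_finsetSum _ fun i _ => (hsq i).const_mul _).const_mul _
  have hnorm : ∑ i, (inner ℝ (e i) (x₀ - xstar) : ℝ) ^ 2 = ‖x₀ - xstar‖ ^ 2 := by
    have := e.sum_sq_norm_inner_right (x₀ - xstar)
    simpa using this
  simp only [hcoord, mul_pow, integral_const_mul, hnorm, Fintype.card_fin] at htot
  refine ⟨?_, ?_⟩
  · simp only [hrisk]
    exact (integrable_const _).add hint
  simp only [hrisk]
  rw [integral_add (integrable_const _) hint, integral_const_mul,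
    integral_finsetSum _ fun i _ => (hsq i).const_mul _]
  simp only [integral_const_mul, integral_const, probReal_univ, smul_eq_mul, one_mul,
    add_sub_cancel_left]
  set F := ∑ i, lam i * ∫ ω, inner ℝ (e i) (acsgd α β x₀ (fun n => ξ n ω) t - xstar) ^ 2 ∂P
    with hF
  set N := ‖x₀ - xstar‖ ^ 2 with hN
  set G := (α + 2 * β) * ∑ i, lam i + 2 * α * d / β with hG
  have hG0 : 0 ≤ G := by positivity
  have hN0 : 0 ≤ N := sq_nonneg _
  have hFsum : ∑ i, lam i * (((t : ℝ) + 1) ^ 2 *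
      ∫ ω, inner ℝ (e i) (acsgd α β x₀ (fun n => ξ n ω) t - xstar) ^ 2 ∂P) =
      ((t : ℝ) + 1) ^ 2 * F := by
    rw [hF, Finset.mul_sum]
    exact Finset.sum_congr rfl fun i _ => by ring
  rw [hFsum] at htot
  have htpos : (0 : ℝ) < t := by exact_mod_cast ht
  have htt : (0 : ℝ) < ((t : ℝ) + 1) ^ 2 := by positivity
  -- The second branch has room to spare: `3 / (β (t + 1))` would suffice in place of `24 / (β t)`.
  have hbias : 3 * min (1 / α) (((t : ℝ) + 1) / β) ≤
      ((t : ℝ) + 1) ^ 2 * min (3 / (α * (t : ℝ) ^ 2)) (24 / (β * (t : ℝ))) := by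
    rw [mul_min_of_nonneg _ _ htt.le, mul_min_of_nonneg _ _ (by norm_num : (0 : ℝ) ≤ 3)]
    refine min_le_min ?_ ?_
    · rw [← mul_div_assoc, ← mul_div_assoc, div_le_div_iff₀ hα (by positivity)]
      nlinarith [mul_pos hα htpos]
    · rw [← mul_div_assoc, ← mul_div_assoc, div_le_div_iff₀ hβ (by positivity)]
      have : 0 < β * ((t : ℝ) + 1) := by positivity
      nlinarith
  have hvar : (t : ℝ) ^ 2 ≤ ((t : ℝ) + 1) ^ 2 := by nlinarith
  refine le_of_mul_le_mul_left ?_ htt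
  have h1 := mul_le_mul_of_nonneg_right hbias hN0
  have h2 := mul_le_mul_of_nonneg_right hvar (mul_nonneg hG0 (sq_nonneg σ))
  -- The argument yields `G σ²`; this term pays for the factor 2 in the claim.
  have h3 : 0 ≤ ((t : ℝ) + 1) ^ 2 * (G * σ ^ 2) := by positivity
  linarith

end Main

theorem theorem2 {d : ℕ} (hd : 0 < d)
    -- the sample distribution, with finite second moments and invertible covariance
    (ρ : Measure (EuclideanSpace ℝ (Fin d) × ℝ)) [IsProbabilityMeasure ρ]
    (ha : Integrable (fun p => ‖p.1‖ ^ 2) ρ) (hb : Integrable (fun p => p.2 ^ 2) ρ)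
    (hH : IsUnit (covMatrix ρ))
    -- the minimizer of the risk
    (xstar : EuclideanSpace ℝ (Fin d)) (hmin : ∀ x, risk ρ xstar ≤ risk ρ x)
    -- the stream of i.i.d. samples
    {Ω : Type*} [MeasurableSpace Ω] (P : Measure Ω) [IsProbabilityMeasure P]
    (ξ : ℕ → Ω → EuclideanSpace ℝ (Fin d) × ℝ)
    (hlaw : ∀ n, HasLaw (ξ n) ρ P) (hindep : iIndepFun ξ P)
    (κ : ℝ) (hκ : UniformKurtosis ρ κ)
    (x₀ : EuclideanSpace ℝ (Fin d)) :
    (∀ σ : ℝ, NoiseLevel ρ xstar σ →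
      ∀ α β : ℝ, 0 < α → 0 < β →
        κ * (α + 2 * β) * (covMatrix ρ).trace ≤ 1 → α ≤ β / (2 * κ * d) →
        ∀ t : ℕ, 1 ≤ t →
          ExcessRiskLE P ρ ξ x₀ xstar α β t
            (min (3 / (α * (t : ℝ) ^ 2)) (24 / (β * (t : ℝ))) * ‖x₀ - xstar‖ ^ 2
              + 2 * ((α + 2 * β) * (covMatrix ρ).trace + 2 * α * d / β) * σ ^ 2)) ∧
    -- noiseless problems: accelerated rate
    ((∀ᵐ p ∂ρ, p.2 = inner ℝ xstar p.1) →
      (∀ α β : ℝ, 0 < β → α = β / (2 * κ * d) →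
        κ * (α + 2 * β) * (covMatrix ρ).trace ≤ 1 →
        ∀ t : ℕ, 1 ≤ t →
          ExcessRiskLE P ρ ξ x₀ xstar α β t
            (6 * κ * d / (β * (t : ℝ) ^ 2) * ‖x₀ - xstar‖ ^ 2)) ∧
      (∀ α β : ℝ, β = 1 / (3 * κ * (covMatrix ρ).trace) → α = 1 / (6 * d * κ ^ 2 * (covMatrix ρ).trace) →
        ∀ t : ℕ, 1 ≤ t →
          ExcessRiskLE P ρ ξ x₀ xstar α β t
            (18 * κ ^ 2 * d * (covMatrix ρ).trace / (t : ℝ) ^ 2 * ‖x₀ - xstar‖ ^ 2))) := by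
  have hκ1 := hκ.one_le hd ha hH
  have hd1 : (1 : ℝ) ≤ d := by exact_mod_cast hd
  have hκd : 1 ≤ κ * d := one_le_mul_of_one_le_of_one_le hκ1 hd1
  have hκ2d : 0 < 2 * κ * d := by linarith
  refine ⟨fun σ hσ α β hα hβ htr hαβ t ht =>
    excessRiskLE_acsgd hd ha hb hH hmin hlaw hindep hκ x₀ hσ hα hβ htr hαβ ht, fun hnoise => ?_⟩
  have accelerated : ∀ α β : ℝ, 0 < β → α = β / (2 * κ * d) →
      κ * (α + 2 * β) * (covMatrix ρ).trace ≤ 1 → ∀ t : ℕ, 1 ≤ t →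
        ExcessRiskLE P ρ ξ x₀ xstar α β t
          (6 * κ * d / (β * (t : ℝ) ^ 2) * ‖x₀ - xstar‖ ^ 2) := by
    intro α β hβ hα htr t ht
    have hα0 : 0 < α := hα ▸ div_pos hβ hκ2d
    refine excessRiskLE_of_le (excessRiskLE_acsgd hd ha hb hH hmin hlaw hindep hκ x₀
      (noiseLevel_zero hnoise) hα0 hβ htr hα.le ht) ?_
    have htpos : (0 : ℝ) < t := by exact_mod_cast ht
    have e : 3 / (α * (t : ℝ) ^ 2) = 6 * κ * d / (β * (t : ℝ) ^ 2) := by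
      have hκ0 : κ ≠ 0 := by linarith
      have hd0 : (d : ℝ) ≠ 0 := by linarith
      rw [hα]
      field_simp
      ring
    rw [← e]
    have := mul_le_mul_of_nonneg_right
      (min_le_left (3 / (α * (t : ℝ) ^ 2)) (24 / (β * (t : ℝ)))) (sq_nonneg ‖x₀ - xstar‖)
    simpa using this
  refine ⟨accelerated, fun α β hβ hα t ht => ?_⟩
  have htrpos : 0 < (covMatrix ρ).trace := by
    rw [trace_covMatrix]
    exact Finset.sum_pos (fun i _ => eigenvalues_covMatrix_pos ha hH i) ⟨⟨0, hd⟩, Finset.mem_univ _⟩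
  have hκ0 : 0 < κ := by linarith
  have hd0 : (0 : ℝ) < d := by linarith
  have hβ0 : 0 < β := by rw [hβ]; positivity
  refine excessRiskLE_of_le (accelerated α β hβ0 ?_ ?_ t ht) (le_of_eq ?_)
  · rw [hα, hβ]
    field_simp
    norm_num
  -- Since `κ d ≥ 1`, the value is at most `1 / 6 + 2 / 3 < 1`.
  · have e : κ * (α + 2 * β) * (covMatrix ρ).trace = 1 / (6 * (κ * d)) + 2 / 3 := by
      rw [hα, hβ]
      field_simp
    rw [e]
    have : 1 / (6 * (κ * d)) ≤ 1 / 6 := by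
      apply one_div_le_one_div_of_le <;> linarith
    linarith
  · have htpos : (0 : ℝ) < t := by exact_mod_cast ht
    rw [hβ]
    field_simp
    ring
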